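/- Conventions. A $\{0,1\}$-coloring of a finite simple graph $G$ is a map $f:V(G)\to\{0,1\}$ with $\sum_{v\in C}f(v)\le 1$ for every clique $C$ and with exactly one vertex of value $1$ in every clique of maximum size $\omega(G)$. A faithful orthogonal representation of $G$ in dimension $d$ assigns to the vertices pairwise non-parallel unit vectors of $\mathbb C^d$ that are orthogonal exactly when the vertices are adjacent; $d^*(G)$ is the least such dimension. A gadget of order $(m,k)$ in dimension $d$ is a finite $\{0,1\}$-colorable graph $G$ with $d^*(G)=\omega(G)=d$ and a distinguished independent set $I$, $|I|=m$, such that every $R\subseteq I$ with $|R|\le k$ is given the value $1$ throughout by some $\{0,1\}$-coloring of $G$, and no $\{0,1\}$-coloring gives the value $1$ to more than $k$ vertices of $I$. The graph. Let $d\ge 3$, $t\ge 0$. The graph $G_{d,t}$ (with $t+1$ repeating units) has the vertices $m_1,\dots,m_d$; $x_1,\dots,x_d$; $n_1,\dots,n_{d-2}$; $n_*$; $v_0,\dots,v_{4t+3}$, where $v_{4t+2}$ is identified with $m_d$. Its edges are: (i) $x_ix_j$ for $i\ne j$, $x_im_i$ for $1\le i\le d-1$, and $x_dv_0$; (ii)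 $v_kv_{k+1}$ for $0\le k\le 4t+2$; (iii) $n_in_j$ for $i\neq j$, and $n_in_*$ for $i\ge2$; (iv) $n_iv_k$ if $k\bmod 4\in\{0,1\}$, or if $k \bmod 4\in\{2,3\}$ and $i\ge 2$; $n_*v_k$ if $k\bmod4\in\{2,3\}$; (v) $n_im_1$ for all $i$; $n_im_{j+1}$ for $1\le j\le d-2$, $i\neq j$; $n_*m_2$. (The edges at $m_d=v_{4t+2}$ are given by (ii) and (iv).) The vectors. For real $\theta$ and $\kappa>0$ put $a=-\dfrac{\cos^2\theta+\kappa^2}{\sin\theta+\sqrt{\sin^2\theta-(d-4)(\cos^2\theta+\kappa^2)}}$, $e=(d-3)a+\sin\theta$, $q=(d-2)\kappa$, $p=\dfrac{e^2+(d-2)\kappa^2}{\cos\theta}$. Let $e_1,\dots,e_d$ be the standard basis and let $V_{d,t}(\theta,\kappa)$ be the following family of vectors, each divided by its norm: $m_1=e_1$; $m_{j+1}=\sin\theta\,e_1+\cos\theta\,e_{j+1}$ for $1\le j\le d-2$; $m_d=\sin\theta\,e_1+\cos\theta\,e_2-\frac pq\sin^{2t+1}\theta\,e_d$; $n_i=e_{i+1}$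 for $1\le i\le d-2$; $n_*=-\cos\theta\,e_1+\sin\theta\,e_2$; $x_1=(0,\kappa,\dots,\kappa,-e)$; $x_{j+1}=(-\cos\theta,a,\dots,a,\kappa)$ with the $(j+1)$-st coordinate replaced by $\sin\theta$, for $1\le j\le d-2$; $x_d=(p,e,\dots,e,q)$; $v_{4j}=-q\,e_1+p\sin^{2j}\theta\,e_d$; $v_{4j+1}=p\sin^{2j}\theta\,e_1+q\,e_d$; $v_{4j+2}=q\sin\theta\,e_1+q\cos\theta\,e_2-p\sin^{2j+1}\theta\,e_d$; $v_{4j+3}=p\sin^{2j+2}\theta\,e_1+p\sin^{2j+1}\theta\cos\theta\,e_2+q\,e_d$. Theorem. Let $d\ge3$. (1) For every $t\ge0$ the graph $G_{d,t}$ with $I=\{m_1,\dots,m_d\}$ is a gadget of order $(d,d-1)$ in dimension $d$. (2) For every $\varepsilon>0$ there is $\delta>0$ such that for every $\theta$ with $0<|\theta-\pi/2|<\delta$ there is $\kappa>0$ such that $V_{d,t}(\theta,\kappa)$ is a faithful orthogonal representation of $G_{d,t}$ in dimension $d$ for all $t\ge0$, and $|\langle m_i|m_j\rangle-1|<\varepsilon$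 for all $i,j$ and all sufficiently large $t$. -/

import Mathlib

open Filter Topology

noncomputable section

/-! ### Zero-one colorings, faithful orthogonal representations, gadgets of order (m,k) -/

/-- A `{0,1}`-coloring of `G`: every clique has total value at most one, and every clique of
maximum size contains exactly one vertex of value `1`. -/
def IsZeroOneColoring {V : Type*} (G : SimpleGraph V) (f : V → Fin 2) : Prop :=
  (∀ C : Finset V, G.IsClique (C : Set V) → ∑ v ∈ C, (f v : ℕ) ≤ 1) ∧
  (∀ C : Finset V, G.IsNClique G.cliqueNum C → ∃! v, v ∈ C ∧ f v = 1)

/-- `f` is a faithful orthogonal representation of `G` in `ℂⁿ`: unit vectors, orthogonal exactly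
on the edges of `G`, and pairwise non-parallel. -/
structure IsFaithfulOrthRep {V : Type*} (G : SimpleGraph V) (n : ℕ)
    (f : V → EuclideanSpace ℂ (Fin n)) : Prop where
  unit : ∀ v, ‖f v‖ = 1
  orth_iff : ∀ u v, inner ℂ (f u) (f v) = 0 ↔ G.Adj u v
  not_parallel : ∀ u v, u ≠ v → ∀ z : ℂ, f u ≠ z • f v

/-- The faithful dimension `d*(G)`: the least `n` such that `G` has a faithful orthogonal
representation in `ℂⁿ`. -/
def faithfulDim {V : Type*} (G : SimpleGraph V) : ℕ :=
  sInf {n : ℕ | ∃ f : V → EuclideanSpace ℂ (Fin n), IsFaithfulOrthRep G n f}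

/-- The graph `G` with the distinguished set of vertices `I` is a gadget of order `(m,k)` in
dimension `d`. -/
structure IsOrderGadget {V : Type*} (G : SimpleGraph V) (I : Set V) (m k d : ℕ) : Prop where
  finite : Finite V
  colorable : ∃ f, IsZeroOneColoring G f
  has_rep : ∃ f : V → EuclideanSpace ℂ (Fin d), IsFaithfulOrthRep G d f
  faithfulDim_eq : faithfulDim G = d
  cliqueNum_eq : G.cliqueNum = d
  indep : G.IsIndepSet I
  ncard_eq : I.ncard = m
  attains : ∀ R ⊆ I, R.ncard ≤ k → ∃ f, IsZeroOneColoring G f ∧ ∀ v ∈ R, f v = 1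
  forbids : ∀ f, IsZeroOneColoring G f → {v ∈ I | f v = 1}.ncard ≤ k

/-! ### The explicit graph -/

/-- Vertices of the graph in dimension `d` with the `t + 1` repeating units numbered `0, …, t`.
All families are numbered from `0`:
`m 0, …, m (d-1)` are the distinguished vertices, `x 0, …, x (d-1)` the initial basis,
`n 0, …, n (d-3)` and `nLast` the `d - 1` vertices that are shared by the repeating units.
Unit number `j` consists of `v_{4j}, v_{4j+1}, v_{4j+2}, v_{4j+3}`. In the last unit `v_{4t+2}` is
the distinguished vertex `m (d-1)` itself, and `w` stands for `v_{4t+3}`; so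
`v 0, …, v (4t+1)` remain. -/
inductive GadgetVertex (d t : ℕ) : Type
  | m (i : Fin d)
  | x (i : Fin d)
  | n (i : Fin (d - 2))
  | nLast
  | v (k : Fin (4 * t + 2))
  | w

/-- The middle coordinate (among `1, …, d-2`) used by the distinguished vector `m j`;
`0` stands for none. Both `m 1` and the last vector `m (d-1)` use coordinate `1`. -/
def anchor (d j : ℕ) : ℕ := if j + 1 = d then 1 else j

/-- The edges of the graph, each listed in one direction. -/
def gadgetRel (d t : ℕ) : GadgetVertex d t → GadgetVertex d t → Prop
  | .x _, .x _ => True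
  | .x i, .m j => i = j ∧ (i : ℕ) + 1 < d
  | .x i, .v k => (i : ℕ) + 1 = d ∧ (k : ℕ) = 0
  | .n _, .n _ => True
  | .n i, .nLast => (i : ℕ) ≠ 0
  | .n i, .m j => (i : ℕ) + 1 ≠ anchor d j
  | .n i, .v k => (k : ℕ) % 4 < 2 ∨ (i : ℕ) ≠ 0
  | .n i, .w => (i : ℕ) ≠ 0
  | .nLast, .m j => anchor d j = 1
  | .nLast, .v k => 2 ≤ (k : ℕ) % 4
  | .nLast, .w => True
  | .v k, .v l => (k : ℕ) + 1 = l
  | .v k, .m j => (k : ℕ) = 4 * t + 1 ∧ (j : ℕ) + 1 = d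
  | .w, .m j => (j : ℕ) + 1 = d
  | _, _ => False

/-- The graph of the construction: the symmetric irreflexive closure of `gadgetRel`. -/
def gadgetGraph (d t : ℕ) : SimpleGraph (GadgetVertex d t) :=
  SimpleGraph.fromRel (gadgetRel d t)

/-! ### The explicit vectors, with parameters `θ` and `κ` -/

/-- The row vector `(a, mid 1, …, mid (d-2), b)`. -/
def rowVec (d : ℕ) (a : ℝ) (mid : ℕ → ℝ) (b : ℝ) : Fin d → ℝ := fun i =>
  if (i : ℕ) = 0 then a else if (i : ℕ) + 1 = d then b else mid i

/-- The root `(-sin θ + √Δ) / (d - 4)`, `Δ = sin² θ - (d - 4)(cos² θ + κ²)`, of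
`(d - 4) a² + 2 a sin θ + cos² θ + κ² = 0`, written so that it is also right for `d = 4`. -/
def coefA (d : ℕ) (θ κ : ℝ) : ℝ :=
  -(Real.cos θ ^ 2 + κ ^ 2) /
    (Real.sin θ + Real.sqrt (Real.sin θ ^ 2 - ((d : ℝ) - 4) * (Real.cos θ ^ 2 + κ ^ 2)))

/-- Middle coordinates of the last vector of the initial basis. -/
def coefE (d : ℕ) (θ κ : ℝ) : ℝ := ((d : ℝ) - 3) * coefA d θ κ + Real.sin θ

/-- Last coordinate of the last vector of the initial basis. -/
def coefQ (d : ℕ) (κ : ℝ) : ℝ := ((d : ℝ) - 2) * κ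

/-- First coordinate of the last vector of the initial basis. -/
def coefP (d : ℕ) (θ κ : ℝ) : ℝ :=
  (coefE d θ κ ^ 2 + ((d : ℝ) - 2) * κ ^ 2) / Real.cos θ

/-- The vectors `v_k` of the repeating units. -/
def unitVec (d : ℕ) (θ κ : ℝ) (k : ℕ) : Fin d → ℝ :=
  let s := Real.sin θ
  let c := Real.cos θ
  let p := coefP d θ κ
  let q := coefQ d κ
  let j := k / 4
  if k % 4 = 0 then rowVec d (-q) (fun _ => 0) (p * s ^ (2 * j))
  else if k % 4 = 1 then rowVec d (p * s ^ (2 * j)) (fun _ => 0) q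
  else if k % 4 = 2 then
    rowVec d (q * s) (fun l => if l = 1 then q * c else 0) (-(p * s ^ (2 * j + 1)))
  else
    rowVec d (p * s ^ (2 * j + 2)) (fun l => if l = 1 then p * s ^ (2 * j + 1) * c else 0) q

/-- The (not yet normalized) vectors of the construction. -/
def rawVec (d t : ℕ) (θ κ : ℝ) : GadgetVertex d t → Fin d → ℝ
  | .m j =>
      if (j : ℕ) = 0 then rowVec d 1 (fun _ => 0) 0
      else if (j : ℕ) + 1 < d then
        rowVec d (Real.sin θ) (fun l => if l = (j : ℕ) then Real.cos θ else 0) 0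
      else
        rowVec d (Real.sin θ) (fun l => if l = 1 then Real.cos θ else 0)
          (-(coefP d θ κ / coefQ d κ * Real.sin θ ^ (2 * t + 1)))
  | .x j =>
      if (j : ℕ) = 0 then rowVec d 0 (fun _ => κ) (-coefE d θ κ)
      else if (j : ℕ) + 1 < d then
        rowVec d (-Real.cos θ) (fun l => if l = (j : ℕ) then Real.sin θ else coefA d θ κ) κ
      else rowVec d (coefP d θ κ) (fun _ => coefE d θ κ) (coefQ d κ)
  | .n i => rowVec d 0 (fun l => if l = (i : ℕ) + 1 then 1 else 0) 0
  | .nLast => rowVec d (-Real.cos θ) (fun l => if l = 1 then Real.sin θ else 0) 0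
  | .v k => unitVec d θ κ k
  | .w => unitVec d θ κ (4 * t + 3)

/-- The vectors of the construction, as unit vectors of `ℂᵈ`. -/
def gadgetVec (d t : ℕ) (θ κ : ℝ) (u : GadgetVertex d t) : EuclideanSpace ℂ (Fin d) :=
  let y : EuclideanSpace ℂ (Fin d) := WithLp.toLp 2 (fun i => (rawVec d t θ κ u i : ℂ))
  ((‖y‖⁻¹ : ℝ) : ℂ) • y

end

/-! Indices below start at 0.

At most `d - 1` ones among the `m j`: suppose all of them have value 1. Then every `x i` except the
last is adjacent to a one, so the clique of the `x i` puts a one on its last member and `v 0` has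
value 0. The shared vertices are all adjacent to `m 0` or `m 1`, hence have value 0. Since `v (2k)`
and `v (2k+1)` complete `d - 2` shared vertices to a maximum clique, the values along the path `v 0,
v 1, …` alternate 0, 1, 0, 1, …. So vertex `4t+2` of the path, which is the last `m`, has value 0, a
contradiction (`exists_m_ne_one`).

Every smaller set is attained: for each `i` there is an independent set that contains all `m j` with
`j ≠ i` and whose complement is `(d - 1)`-colorable. It therefore meets every clique of size `d`
(`isZeroOneColoring_omitColoring`).

The vectors: orthogonality on the edges amounts to a few identities between the coefficients, one of
them the quadratic equation for `a`. Most non-edges give inner products of visible sign, or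
multiples of a difference of two distinct powers of `sin θ`; the others give the conditions
collected in `Params.Good` (`Params.Good.dot_eq_zero_iff`). Some of these hold for `θ` near `π/2`
and `κ` near 0; the rest exclude countably many `κ`, uniformly in `t` (`exists_good`). Vectors of
distinct vertices are not parallel because distinct vertices have distinct neighbourhoods. Cliques
become orthonormal families, which gives both the clique number and the minimality of `d`.

The overlaps: `⟨m i, m j⟩` before normalization is at least `sin² θ`, and the squared norms are at
most 1 plus a term that tends to 0 as `t` grows (`eventually_norm_inner_sub_one_lt`). -/

/-! ### Kinds of vertices, with the path of the repeating units made uniform -/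

/-- The vertices of the construction, with the last distinguished vertex and `w` counted among the
vertices `v k` of the repeating units. -/
inductive Kind : Type
  | m (j : ℕ)
  | x (j : ℕ)
  | n (i : ℕ)
  | star
  | v (k : ℕ)

namespace Kind

/-- The range of the indices in dimension `d`. -/
def Valid (d : ℕ) : Kind → Prop
  | m j => j + 1 < d
  | x j => j < d
  | n i => i + 2 < d
  | star => True
  | v _ => True

/-- The edges between the kinds, each listed in one direction. -/
def Rel (d : ℕ) : Kind → Kind → Prop
  | x i, x j => i ≠ j
  | x i, m j => i = j
  | x i, v k => i + 1 = d ∧ k = 0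
  | n i, n j => i ≠ j
  | n i, star => i ≠ 0
  | n i, m j => i + 1 ≠ j
  | n i, v k => k % 4 < 2 ∨ i ≠ 0
  | star, m j => j = 1
  | star, v k => 2 ≤ k % 4
  | v k, v l => k + 1 = l
  | _, _ => False

/-- Adjacency of kinds. -/
def Adj (d : ℕ) (a b : Kind) : Prop := Rel d a b ∨ Rel d b a

end Kind

namespace GadgetVertex

/-- The kind of a vertex. -/
def kind {d t : ℕ} : GadgetVertex d t → Kind
  | m j => if (j : ℕ) + 1 < d then Kind.m j else Kind.v (4 * t + 2)
  | x j => Kind.x j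
  | n i => Kind.n i
  | nLast => Kind.star
  | v k => Kind.v k
  | w => Kind.v (4 * t + 3)

theorem kind_valid {d t : ℕ} (u : GadgetVertex d t) : u.kind.Valid d := by
  cases u with
  | m j => simp only [kind]; split_ifs <;> simp_all [Kind.Valid]
  | n i => have := i.2; simp only [kind, Kind.Valid]; omega
  | x j => exact j.2
  | _ => simp [kind, Kind.Valid]

theorem kind_injective {d t : ℕ} : Function.Injective (kind : GadgetVertex d t → Kind) := by
  intro u u' h
  cases u <;> cases u' <;> simp only [kind] at h <;> (try split_ifs at h) <;>
    simp_all [Fin.ext_iff] <;> omega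

instance {d t : ℕ} : Finite (GadgetVertex d t) := by
  refine Finite.of_injective
    (β := Fin d ⊕ Fin d ⊕ Fin (d - 2) ⊕ Unit ⊕ Fin (4 * t + 2) ⊕ Unit)
    (fun u => match u with
      | m j => .inl j
      | x j => .inr (.inl j)
      | n i => .inr (.inr (.inl i))
      | nLast => .inr (.inr (.inr (.inl ())))
      | v k => .inr (.inr (.inr (.inr (.inl k))))
      | w => .inr (.inr (.inr (.inr (.inr ()))))) ?_
  intro u u' h
  cases u <;> cases u' <;> first | rfl | (cases h; rfl) | cases h

end GadgetVertex

open GadgetVertex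

theorem gadgetGraph_adj_iff {d t : ℕ} (u u' : GadgetVertex d t) :
    (gadgetGraph d t).Adj u u' ↔ Kind.Adj d u.kind u'.kind := by
  rw [gadgetGraph, SimpleGraph.fromRel_adj]
  cases u <;> cases u' <;> simp only [kind, gadgetRel, Kind.Adj, anchor] <;>
    (try split_ifs) <;> simp only [Kind.Rel, ne_eq, m.injEq, x.injEq, n.injEq, v.injEq, reduceCtorEq,
      Fin.ext_iff, not_false_eq_true, not_true_eq_false, true_and, and_true, and_false,
      true_or, or_true, false_or, or_false] <;> grind

/-! ### Dot products of row vectors -/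

/-- The part of the dot product of two row vectors that comes from the middle coordinates. -/
def midSum (d : ℕ) (f g : ℕ → ℝ) : ℝ := ∑ l ∈ Finset.range (d - 2), f (l + 1) * g (l + 1)

theorem rowVec_dotProduct {d : ℕ} (hd : 3 ≤ d) (a b a' b' : ℝ) (f g : ℕ → ℝ) :
    dotProduct (rowVec d a f b) (rowVec d a' g b') = a * a' + midSum d f g + b * b' := by
  obtain ⟨D, rfl⟩ : ∃ D, d = D + 2 := ⟨d - 2, by omega⟩
  rw [dotProduct, Fin.sum_univ_succ, Fin.sum_univ_castSucc, ← add_assoc]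
  simp only [midSum, Nat.add_sub_cancel, Finset.sum_range]
  congr 1
  · congr 1
    refine Finset.sum_congr rfl fun i _ => ?_
    have := i.2
    simp [rowVec, this.ne]
  · simp [rowVec]

theorem midSum_comm (d : ℕ) (f g : ℕ → ℝ) : midSum d f g = midSum d g f := by
  simp only [midSum, mul_comm]

theorem midSum_zero_right (d : ℕ) (f : ℕ → ℝ) : midSum d f (fun _ => 0) = 0 := by
  simp [midSum]

theorem midSum_zero_left (d : ℕ) (f : ℕ → ℝ) : midSum d (fun _ => 0) f = 0 := by
  simp [midSum]

theorem midSum_single_zero (d : ℕ) (f : ℕ → ℝ) (z : ℝ) :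
    midSum d f (fun l => if l = 0 then z else 0) = 0 := by
  simp [midSum]

theorem midSum_single {d j : ℕ} (h1 : 1 ≤ j) (hj : j + 1 < d) (f : ℕ → ℝ) (z : ℝ) :
    midSum d f (fun l => if l = j then z else 0) = f j * z := by
  obtain ⟨i, rfl⟩ : ∃ i, j = i + 1 := ⟨j - 1, by omega⟩
  rw [midSum, Finset.sum_eq_single i]
  · simp
  · intro b _ hb
    simp [hb]
  · intro h
    simp at h
    omega

theorem midSum_const {d : ℕ} (hd : 3 ≤ d) (a b : ℝ) :
    midSum d (fun _ => a) (fun _ => b) = ((d : ℝ) - 2) * (a * b) := by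
  have : ((d - 2 : ℕ) : ℝ) = (d : ℝ) - 2 := by push_cast [show 2 ≤ d by omega]; ring
  simp [midSum, this]

/-- A constant row with one exceptional entry is the constant row plus a multiple of a unit vector;
the middle `x` vectors have this form. -/
theorem midSum_spike {d j : ℕ} (h1 : 1 ≤ j) (hj : j + 1 < d) (f : ℕ → ℝ) (a z : ℝ) :
    midSum d f (fun l => if l = j then z else a) =
      midSum d f (fun _ => a) + f j * (z - a) := by
  rw [← midSum_single h1 hj, midSum, midSum, midSum, ← Finset.sum_add_distrib]
  refine Finset.sum_congr rfl fun l _ => ?_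
  split_ifs <;> ring

/-! ### Parameters and vectors, independent of the number of units -/

/-- The numbers from which the vectors of the construction are formed. -/
structure Params where
  s : ℝ
  c : ℝ
  κ : ℝ
  a : ℝ
  e : ℝ
  p : ℝ
  q : ℝ

namespace Params

/-- The conditions under which the vectors are orthogonal exactly on the edges. -/
structure Good (d : ℕ) (P : Params) : Prop where
  dim : 3 ≤ d
  s_pos : 0 < P.s
  s_lt : P.s < 1
  c_ne : P.c ≠ 0
  sq_add : P.s ^ 2 + P.c ^ 2 = 1
  κ_pos : 0 < P.κ
  a_neg : P.a < 0
  e_pos : 0 < P.e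
  -- The four identities that follow say that the vectors `x i` are pairwise orthogonal.
  quad : P.c ^ 2 + ((d : ℝ) - 4) * P.a ^ 2 + 2 * P.a * P.s + P.κ ^ 2 = 0
  e_eq : P.e = ((d : ℝ) - 3) * P.a + P.s
  q_eq : P.q = ((d : ℝ) - 2) * P.κ
  p_eq : P.p * P.c = P.e ^ 2 + ((d : ℝ) - 2) * P.κ ^ 2
  -- From here on: non-edges at some `x i` whose inner product has terms of opposite sign that the
  -- conditions above do not keep apart.
  x_star : P.c ^ 2 + P.s * P.a ≠ 0
  x_last_star : P.p * P.c ≠ P.s * P.e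
  x_zero_v : ∀ j : ℕ, P.p * P.c * P.s ^ (2 * j + 1) ≠ ((d : ℝ) - 2) * P.e
  x_v_one : ∀ j : ℕ, P.p * P.c * P.s ^ (2 * j) ≠ ((d : ℝ) - 2) * P.κ ^ 2
  x_v_three : ∀ j : ℕ,
    P.p * P.c * P.s ^ (2 * j + 1) * (P.s - P.a) ≠ ((d : ℝ) - 2) * P.κ ^ 2

/-- The vectors of the repeating units. -/
noncomputable def unitVec (d : ℕ) (P : Params) (k : ℕ) : Fin d → ℝ :=
  if k % 4 = 0 then rowVec d (-P.q) (fun _ => 0) (P.p * P.s ^ (2 * (k / 4)))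
  else if k % 4 = 1 then rowVec d (P.p * P.s ^ (2 * (k / 4))) (fun _ => 0) P.q
  else if k % 4 = 2 then
    rowVec d (P.q * P.s) (fun l => if l = 1 then P.q * P.c else 0)
      (-(P.p * P.s ^ (2 * (k / 4) + 1)))
  else
    rowVec d (P.p * P.s ^ (2 * (k / 4) + 2))
      (fun l => if l = 1 then P.p * P.s ^ (2 * (k / 4) + 1) * P.c else 0) P.q

/-- The vectors of the construction, up to scaling. -/
noncomputable def vec (d : ℕ) (P : Params) : Kind → Fin d → ℝ
  | .m j => rowVec d (if j = 0 then 1 else P.s) (fun l => if l = j then P.c else 0) 0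
  | .x j =>
      if j = 0 then rowVec d 0 (fun _ => P.κ) (-P.e)
      else if j + 1 < d then
        rowVec d (-P.c) (fun l => if l = j then P.s else P.a) P.κ
      else rowVec d P.p (fun _ => P.e) P.q
  | .n i => rowVec d 0 (fun l => if l = i + 1 then 1 else 0) 0
  | .star => rowVec d (-P.c) (fun l => if l = 1 then P.s else 0) 0
  | .v k => P.unitVec d k

variable {d : ℕ} {P : Params}

theorem unitVec_zero (j : ℕ) :
    P.unitVec d (4 * j) = rowVec d (-P.q) (fun _ => 0) (P.p * P.s ^ (2 * j)) := by
  simp [unitVec]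

theorem unitVec_one (j : ℕ) :
    P.unitVec d (4 * j + 1) = rowVec d (P.p * P.s ^ (2 * j)) (fun _ => 0) P.q := by
  have h1 : (4 * j + 1) % 4 = 1 := by omega
  have h2 : (4 * j + 1) / 4 = j := by omega
  simp [unitVec, h1, h2]

theorem unitVec_two (j : ℕ) :
    P.unitVec d (4 * j + 2) = rowVec d (P.q * P.s) (fun l => if l = 1 then P.q * P.c else 0)
      (-(P.p * P.s ^ (2 * j + 1))) := by
  have h1 : (4 * j + 2) % 4 = 2 := by omega
  have h2 : (4 * j + 2) / 4 = j := by omega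
  simp [unitVec, h1, h2]

theorem unitVec_three (j : ℕ) :
    P.unitVec d (4 * j + 3) = rowVec d (P.p * P.s ^ (2 * j + 2))
      (fun l => if l = 1 then P.p * P.s ^ (2 * j + 1) * P.c else 0) P.q := by
  have h1 : (4 * j + 3) % 4 = 3 := by omega
  have h2 : (4 * j + 3) / 4 = j := by omega
  simp [unitVec, h1, h2]

theorem vec_x_zero : P.vec d (.x 0) = rowVec d 0 (fun _ => P.κ) (-P.e) := by simp [vec]

theorem vec_x_mid {j : ℕ} (h1 : 1 ≤ j) (hj : j + 1 < d) :
    P.vec d (.x j) = rowVec d (-P.c) (fun l => if l = j then P.s else P.a) P.κ := by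
  simp [vec, hj, show j ≠ 0 by omega]

theorem vec_x_last {j : ℕ} (h1 : 1 ≤ j) (hj : j + 1 = d) :
    P.vec d (.x j) = rowVec d P.p (fun _ => P.e) P.q := by
  simp [vec, hj, show j ≠ 0 by omega]

theorem vec_m_zero :
    P.vec d (.m 0) = rowVec d 1 (fun l => if l = 0 then P.c else 0) 0 := by
  simp [vec]

theorem vec_m_mid {j : ℕ} (h1 : 1 ≤ j) :
    P.vec d (.m j) = rowVec d P.s (fun l => if l = j then P.c else 0) 0 := by
  simp [vec, show j ≠ 0 by omega]

theorem vec_n (i : ℕ) : P.vec d (.n i) = rowVec d 0 (fun l => if l = i + 1 then 1 else 0) 0 := rfl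

theorem vec_star :
    P.vec d .star = rowVec d (-P.c) (fun l => if l = 1 then P.s else 0) 0 := rfl

theorem vec_v (k : ℕ) : P.vec d (.v k) = P.unitVec d k := rfl

theorem exists_four_mul_add (k : ℕ) :
    ∃ j, k = 4 * j ∨ k = 4 * j + 1 ∨ k = 4 * j + 2 ∨ k = 4 * j + 3 := ⟨k / 4, by omega⟩

/-- The angle may lie on either side of `π/2`, so `c` and `p` have unknown signs and only `p * c` is
known to be positive. Multiplying an inner product by `c` turns its terms into terms of known sign.
-/
theorem ne_zero_of_mul_pos {x c : ℝ} (h : 0 < x * c) : x ≠ 0 := left_ne_zero_of_mul h.ne'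

/-! ### Orthogonality exactly on the edges -/

namespace Good

variable (h : P.Good d)
include h

theorem one_le_sub : (1 : ℝ) ≤ (d : ℝ) - 2 := by
  have : (3 : ℝ) ≤ d := by exact_mod_cast h.dim
  linarith

theorem q_pos : 0 < P.q := by
  have := h.one_le_sub
  have := h.κ_pos
  rw [h.q_eq]
  positivity

theorem pc_pos : 0 < P.p * P.c := by
  have := h.one_le_sub
  have := h.κ_pos
  have := h.e_pos
  rw [h.p_eq]
  positivity

theorem p_ne : P.p ≠ 0 := left_ne_zero_of_mul h.pc_pos.ne'

theorem pow_inj {i j : ℕ} : P.s ^ i = P.s ^ j ↔ i = j :=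
  pow_right_inj₀ h.s_pos h.s_lt.ne

/-- Two middle vectors are orthogonal by `quad`, the first and a middle one by `e_eq`, the first and
the last by `q_eq`, a middle one and the last by `p_eq` together with `e_eq` and `q_eq`. -/
theorem dot_x_x {i j : ℕ} (hi : i < d) (hj : j < d) :
    dotProduct (P.vec d (.x i)) (P.vec d (.x j)) = 0 ↔ i ≠ j := by
  have hD := h.one_le_sub
  have hκ := h.κ_pos
  have he := h.e_pos
  have hq := h.q_pos
  have hp := h.p_ne
  have hc := h.c_ne
  rcases Nat.eq_zero_or_pos i with rfl | hi0 <;> rcases Nat.eq_zero_or_pos j with rfl | hj0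
  · simp only [vec_x_zero, rowVec_dotProduct h.dim, midSum_const h.dim]
    simp only [ne_eq, not_true_eq_false, iff_false]
    nlinarith
  · rcases (show j + 1 < d ∨ j + 1 = d by omega) with hj1 | hj1
    · rw [vec_x_zero, vec_x_mid hj0 hj1]
      simp only [rowVec_dotProduct h.dim, midSum_const h.dim, midSum_spike hj0 hj1]
      refine iff_of_true ?_ (by omega)
      rw [h.e_eq]; ring
    · rw [vec_x_zero, vec_x_last hj0 hj1]
      simp only [rowVec_dotProduct h.dim, midSum_const h.dim]
      refine iff_of_true ?_ (by omega)
      rw [h.q_eq]; ring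
  · rcases (show i + 1 < d ∨ i + 1 = d by omega) with hi1 | hi1
    · rw [dotProduct_comm, vec_x_zero, vec_x_mid hi0 hi1]
      simp only [rowVec_dotProduct h.dim, midSum_const h.dim, midSum_spike hi0 hi1]
      refine iff_of_true ?_ (by omega)
      rw [h.e_eq]; ring
    · rw [vec_x_zero, vec_x_last hi0 hi1]
      simp only [rowVec_dotProduct h.dim, midSum_const h.dim]
      refine iff_of_true ?_ (by omega)
      rw [h.q_eq]; ring
  · rcases (show i + 1 < d ∨ i + 1 = d by omega) with hi1 | hi1 <;>
    rcases (show j + 1 < d ∨ j + 1 = d by omega) with hj1 | hj1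
    · rw [vec_x_mid hi0 hi1, vec_x_mid hj0 hj1, rowVec_dotProduct h.dim, midSum_spike hj0 hj1,
        midSum_comm, midSum_spike hi0 hi1, midSum_const h.dim]
      rcases eq_or_ne i j with rfl | hij
      · simp only [if_true, ne_eq, not_true_eq_false, iff_false]
        have h1 : 0 < P.c ^ 2 := by positivity
        have h2 : 0 ≤ ((d : ℝ) - 3) * P.a ^ 2 := mul_nonneg (by linarith) (sq_nonneg _)
        have h3 : 0 ≤ P.s ^ 2 := sq_nonneg _
        nlinarith [sq_nonneg P.κ]
      · rw [if_neg hij.symm]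
        refine iff_of_true ?_ hij
        linear_combination h.quad
    · rw [vec_x_mid hi0 hi1, vec_x_last hj0 hj1, dotProduct_comm, rowVec_dotProduct h.dim,
        midSum_spike hi0 hi1, midSum_const h.dim]
      refine iff_of_true ?_ (by omega)
      linear_combination P.e * (-h.e_eq) + P.κ * h.q_eq - h.p_eq
    · rw [vec_x_mid hj0 hj1, vec_x_last hi0 hi1, rowVec_dotProduct h.dim,
        midSum_spike hj0 hj1, midSum_const h.dim]
      refine iff_of_true ?_ (by omega)
      linear_combination P.e * (-h.e_eq) + P.κ * h.q_eq - h.p_eq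
    · rw [vec_x_last hi0 hi1, vec_x_last hj0 hj1, rowVec_dotProduct h.dim, midSum_const h.dim]
      refine iff_of_false ?_ (by omega)
      have := mul_self_pos.2 hp
      positivity

theorem dot_x_m {i j : ℕ} (hi : i < d) (hj : j + 1 < d) :
    dotProduct (P.vec d (.x i)) (P.vec d (.m j)) = 0 ↔ i = j := by
  have hD := h.one_le_sub
  have hκ := h.κ_pos
  have he := h.e_pos
  have hp := h.p_ne
  have hpc := h.pc_pos
  have hs := h.s_pos
  have ha := h.a_neg
  have hc := h.c_ne
  rcases Nat.eq_zero_or_pos j with rfl | hj0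
  · rcases Nat.eq_zero_or_pos i with rfl | hi0
    · rw [vec_x_zero, vec_m_zero, rowVec_dotProduct h.dim, midSum_single_zero]
      simp
    · rcases (show i + 1 < d ∨ i + 1 = d by omega) with hi1 | hi1
      · rw [vec_x_mid hi0 hi1, vec_m_zero, rowVec_dotProduct h.dim, midSum_single_zero]
        simp [hc]; omega
      · rw [vec_x_last hi0 hi1, vec_m_zero, rowVec_dotProduct h.dim, midSum_single_zero]
        simp [hp]; omega
  · rw [vec_m_mid hj0]
    rcases Nat.eq_zero_or_pos i with rfl | hi0
    · rw [vec_x_zero, rowVec_dotProduct h.dim, midSum_single hj0 hj]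
      simp [hκ.ne', hc]; omega
    · rcases (show i + 1 < d ∨ i + 1 = d by omega) with hi1 | hi1
      · rw [vec_x_mid hi0 hi1, rowVec_dotProduct h.dim, midSum_single hj0 hj]
        rcases eq_or_ne i j with rfl | hij
        · refine iff_of_true ?_ rfl
          rw [if_pos rfl]; ring
        · refine iff_of_false ?_ hij
          rw [if_neg hij.symm, show -P.c * P.s + P.a * P.c + P.κ * 0 = P.c * (P.a - P.s) by ring]
          exact mul_ne_zero hc (by linarith)
      · rw [vec_x_last hi0 hi1, rowVec_dotProduct h.dim, midSum_single hj0 hj]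
        refine iff_of_false (ne_zero_of_mul_pos (c := P.c) ?_) (by omega)
        rw [show (P.p * P.s + P.e * P.c + P.q * 0) * P.c = P.p * P.c * P.s + P.e * P.c ^ 2 by ring]
        positivity

theorem dot_x_n {i j : ℕ} (hi : i < d) (hj : j + 2 < d) :
    dotProduct (P.vec d (.x i)) (P.vec d (.n j)) ≠ 0 := by
  have hs := h.s_pos
  rw [vec_n]
  rcases Nat.eq_zero_or_pos i with rfl | hi0
  · rw [vec_x_zero, rowVec_dotProduct h.dim, midSum_single (by omega) (by omega)]
    simp [h.κ_pos.ne']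
  · rcases (show i + 1 < d ∨ i + 1 = d by omega) with hi1 | hi1
    · rw [vec_x_mid hi0 hi1, rowVec_dotProduct h.dim, midSum_single (by omega) (by omega)]
      split_ifs <;> simp [hs.ne', h.a_neg.ne]
    · rw [vec_x_last hi0 hi1, rowVec_dotProduct h.dim, midSum_single (by omega) (by omega)]
      simp [h.e_pos.ne']

theorem dot_x_star {i : ℕ} (hi : i < d) :
    dotProduct (P.vec d (.x i)) (P.vec d .star) ≠ 0 := by
  have hs := h.s_pos
  have hd := h.dim
  rw [vec_star]
  rcases Nat.eq_zero_or_pos i with rfl | hi0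
  · rw [vec_x_zero, rowVec_dotProduct h.dim, midSum_single (by omega) (by omega)]
    simp [h.κ_pos.ne', hs.ne']
  · rcases (show i + 1 < d ∨ i + 1 = d by omega) with hi1 | hi1
    · rw [vec_x_mid hi0 hi1, rowVec_dotProduct h.dim, midSum_single (by omega) (by omega)]
      split_ifs
      · nlinarith [h.sq_add]
      · intro h0
        exact h.x_star (by linear_combination h0)
    · rw [vec_x_last hi0 hi1, rowVec_dotProduct h.dim, midSum_single (by omega) (by omega)]
      intro h0
      exact h.x_last_star (by linear_combination -h0)

end Good

end Params

namespace Params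

variable {d : ℕ} {P : Params}

namespace Good

variable (h : P.Good d)
include h

/-- For the last `x` and `v (4j)` the product is a multiple of `s ^ (2j) - 1`, which vanishes only
for `j = 0`. Apart from the combinations covered by `x_zero_v`, `x_v_one` and `x_v_three`, the other
products have a definite sign, if need be after multiplication by `c`, or are products of nonzero
factors. -/
theorem dot_x_v {i : ℕ} (hi : i < d) (k : ℕ) :
    dotProduct (P.vec d (.x i)) (P.vec d (.v k)) = 0 ↔ i + 1 = d ∧ k = 0 := by
  have hd := h.dim
  have hD := h.one_le_sub
  have hκ := h.κ_pos
  have he := h.e_pos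
  have hq := h.q_pos
  have hp := h.p_ne
  have hpc := h.pc_pos
  have hs := h.s_pos
  have ha := h.a_neg
  have hc := h.c_ne
  have hc2 : 0 < P.c ^ 2 := by positivity
  have hspow (n : ℕ) : 0 < P.s ^ n := by positivity
  rw [vec_v]
  rcases Nat.eq_zero_or_pos i with rfl | hi0
  · rw [vec_x_zero]
    refine iff_of_false ?_ (by omega)
    obtain ⟨j, rfl | rfl | rfl | rfl⟩ := exists_four_mul_add k
    · rw [unitVec_zero, rowVec_dotProduct hd, midSum_zero_right]
      simp [he.ne', hp, hs.ne']
    · rw [unitVec_one, rowVec_dotProduct hd, midSum_zero_right]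
      simp [he.ne', hq.ne']
    · rw [unitVec_two, rowVec_dotProduct hd, midSum_single le_rfl (by omega)]
      refine ne_zero_of_mul_pos (c := P.c) ?_
      have := hspow (2 * j + 1)
      rw [show (0 * (P.q * P.s) + P.κ * (P.q * P.c) + -P.e * -(P.p * P.s ^ (2 * j + 1))) * P.c =
        P.κ * P.q * P.c ^ 2 + P.e * (P.p * P.c) * P.s ^ (2 * j + 1) by ring]
      positivity
    · rw [unitVec_three, rowVec_dotProduct hd, midSum_single le_rfl (by omega), h.q_eq]
      intro h0
      refine h.x_zero_v j (mul_left_cancel₀ hκ.ne' ?_)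
      linear_combination h0
  rcases (show i + 1 < d ∨ i + 1 = d by omega) with hi1 | hi1
  · rw [vec_x_mid hi0 hi1]
    refine iff_of_false ?_ (by omega)
    obtain ⟨j, rfl | rfl | rfl | rfl⟩ := exists_four_mul_add k
    · rw [unitVec_zero, rowVec_dotProduct hd, midSum_zero_right]
      refine ne_zero_of_mul_pos (c := P.c) ?_
      have := hspow (2 * j)
      rw [show (-P.c * -P.q + 0 + P.κ * (P.p * P.s ^ (2 * j))) * P.c =
        P.q * P.c ^ 2 + P.κ * (P.p * P.c) * P.s ^ (2 * j) by ring]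
      positivity
    · rw [unitVec_one, rowVec_dotProduct hd, midSum_zero_right, h.q_eq]
      intro h0
      exact h.x_v_one j (by linear_combination -h0)
    · rw [unitVec_two, rowVec_dotProduct hd, midSum_single le_rfl (by omega)]
      have h1 : 0 ≤ P.s - (if 1 = i then P.s else P.a) := by
        split_ifs <;> linarith
      generalize (if 1 = i then P.s else P.a) = b at h1
      rw [← neg_eq_zero]
      refine ne_zero_of_mul_pos (c := P.c) ?_
      have := hspow (2 * j + 1)
      rw [show -(-P.c * (P.q * P.s) + b * (P.q * P.c) + P.κ * -(P.p * P.s ^ (2 * j + 1))) * P.c =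
        P.q * P.c ^ 2 * (P.s - b) + P.κ * (P.p * P.c) * P.s ^ (2 * j + 1) by ring]
      have : 0 < P.κ * (P.p * P.c) * P.s ^ (2 * j + 1) := by positivity
      have : 0 ≤ P.q * P.c ^ 2 * (P.s - b) := by positivity
      linarith
    · rw [unitVec_three, rowVec_dotProduct hd, midSum_single le_rfl (by omega)]
      split_ifs
      · rw [show -P.c * (P.p * P.s ^ (2 * j + 2)) + P.s * (P.p * P.s ^ (2 * j + 1) * P.c) +
          P.κ * P.q = P.κ * P.q by ring]
        positivity
      · rw [h.q_eq]
        intro h0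
        exact h.x_v_three j (by linear_combination -h0)
  · rw [vec_x_last hi0 hi1]
    obtain ⟨j, rfl | rfl | rfl | rfl⟩ := exists_four_mul_add k
    · rw [unitVec_zero, rowVec_dotProduct hd, midSum_zero_right,
        show P.p * -P.q + 0 + P.q * (P.p * P.s ^ (2 * j)) =
          P.p * P.q * (P.s ^ (2 * j) - P.s ^ 0) by ring,
        mul_eq_zero_iff_left (by positivity), sub_eq_zero, h.pow_inj]
      omega
    · refine iff_of_false ?_ (by omega)
      rw [unitVec_one, rowVec_dotProduct hd, midSum_zero_right]
      have := hspow (2 * j)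
      have := mul_self_pos.2 hp
      rw [show P.p * (P.p * P.s ^ (2 * j)) + 0 + P.q * P.q =
        P.p * P.p * P.s ^ (2 * j) + P.q * P.q by ring]
      positivity
    · refine iff_of_false (ne_zero_of_mul_pos (c := P.c) ?_) (by omega)
      rw [unitVec_two, rowVec_dotProduct hd, midSum_single le_rfl (by omega)]
      have h1 : P.s ^ (2 * j) ≤ 1 := pow_le_one₀ hs.le h.s_lt.le
      rw [show (P.p * (P.q * P.s) + P.e * (P.q * P.c) + P.q * -(P.p * P.s ^ (2 * j + 1))) * P.c =
        P.q * (P.p * P.c) * P.s * (1 - P.s ^ (2 * j)) + P.e * P.q * P.c ^ 2 by ring]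
      have : 0 < P.e * P.q * P.c ^ 2 := by positivity
      have : 0 ≤ P.q * (P.p * P.c) * P.s * (1 - P.s ^ (2 * j)) :=
        mul_nonneg (by positivity) (by linarith)
      linarith
    · refine iff_of_false ?_ (by omega)
      rw [unitVec_three, rowVec_dotProduct hd, midSum_single le_rfl (by omega)]
      have := hspow (2 * j + 2)
      have := hspow (2 * j + 1)
      have := mul_self_pos.2 hp
      rw [show P.p * (P.p * P.s ^ (2 * j + 2)) + P.e * (P.p * P.s ^ (2 * j + 1) * P.c) + P.q * P.q =
        P.p * P.p * P.s ^ (2 * j + 2) + P.e * P.s ^ (2 * j + 1) * (P.p * P.c) + P.q * P.q by ring]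
      positivity

theorem dot_m_m {i j : ℕ} (hj : j + 1 < d) :
    dotProduct (P.vec d (.m i)) (P.vec d (.m j)) ≠ 0 := by
  have hd := h.dim
  have hs := h.s_pos
  rcases Nat.eq_zero_or_pos i with rfl | hi0 <;> rcases Nat.eq_zero_or_pos j with rfl | hj0
  · rw [vec_m_zero, rowVec_dotProduct hd, midSum_single_zero]
    simp
  · rw [vec_m_zero, vec_m_mid hj0, dotProduct_comm, rowVec_dotProduct hd, midSum_single_zero]
    simp [hs.ne']
  · rw [vec_m_zero, vec_m_mid hi0, rowVec_dotProduct hd, midSum_single_zero]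
    simp [hs.ne']
  · rw [vec_m_mid hi0, vec_m_mid hj0, rowVec_dotProduct hd, midSum_single hj0 hj]
    split_ifs <;> nlinarith [mul_self_nonneg P.c, mul_pos hs hs]

theorem dot_n_m {i j : ℕ} (hj : j + 1 < d) :
    dotProduct (P.vec d (.n i)) (P.vec d (.m j)) = 0 ↔ i + 1 ≠ j := by
  have hd := h.dim
  have hc := h.c_ne
  rcases Nat.eq_zero_or_pos j with rfl | hj0
  · rw [vec_m_zero, vec_n, rowVec_dotProduct hd, midSum_single_zero]
    simp
  · rw [vec_m_mid hj0, vec_n, rowVec_dotProduct hd, midSum_single hj0 hj]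
    simp [hc, eq_comm]

theorem dot_star_m {j : ℕ} (hj : j + 1 < d) :
    dotProduct (P.vec d .star) (P.vec d (.m j)) = 0 ↔ j = 1 := by
  have hd := h.dim
  have hc := h.c_ne
  have hs := h.s_pos.ne'
  rcases Nat.eq_zero_or_pos j with rfl | hj0
  · rw [vec_m_zero, vec_star, rowVec_dotProduct hd, midSum_single_zero]
    simp [hc]
  · rw [vec_m_mid hj0, vec_star, rowVec_dotProduct hd, midSum_single hj0 hj]
    by_cases hj1 : j = 1
    · refine iff_of_true ?_ hj1
      rw [if_pos hj1]; ring
    · simp [hc, hs, hj1]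

theorem dot_m_v {i : ℕ} (hi : i + 1 < d) (k : ℕ) :
    dotProduct (P.vec d (.m i)) (P.vec d (.v k)) ≠ 0 := by
  have hd := h.dim
  have hc := h.c_ne
  have hs := h.s_pos
  have hq := h.q_pos
  have hp := h.p_ne
  rw [vec_v]
  rcases Nat.eq_zero_or_pos i with rfl | hi0
  · rw [vec_m_zero, dotProduct_comm]
    obtain ⟨j, rfl | rfl | rfl | rfl⟩ := exists_four_mul_add k
    · rw [unitVec_zero, rowVec_dotProduct hd, midSum_single_zero]
      simp [hq.ne']
    · rw [unitVec_one, rowVec_dotProduct hd, midSum_single_zero]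
      simp [hp, hs.ne']
    · rw [unitVec_two, rowVec_dotProduct hd, midSum_single_zero]
      simp [hq.ne', hs.ne']
    · rw [unitVec_three, rowVec_dotProduct hd, midSum_single_zero]
      simp [hp, hs.ne']
  · rw [vec_m_mid hi0]
    obtain ⟨j, rfl | rfl | rfl | rfl⟩ := exists_four_mul_add k
    · rw [unitVec_zero, rowVec_dotProduct hd, midSum_zero_right]
      simp [hq.ne', hs.ne']
    · rw [unitVec_one, rowVec_dotProduct hd, midSum_zero_right]
      simp [hp, hs.ne']
    · rw [unitVec_two, rowVec_dotProduct hd, midSum_single le_rfl (by omega)]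
      have : 0 < P.s * (P.q * P.s) := by positivity
      have : 0 ≤ P.q * (P.c * P.c) := mul_nonneg hq.le (mul_self_nonneg _)
      split_ifs <;> nlinarith
    · rw [unitVec_three, rowVec_dotProduct hd, midSum_single le_rfl (by omega)]
      split_ifs
      · rw [show P.s * (P.p * P.s ^ (2 * j + 2)) + P.c * (P.p * P.s ^ (2 * j + 1) * P.c) + 0 * P.q =
          P.p * P.s ^ (2 * j + 1) * (P.s ^ 2 + P.c ^ 2) by ring, h.sq_add]
        simp [hp, hs.ne']
      · simp [hp, hs.ne']

theorem dot_n_n {i j : ℕ} (hj : j + 2 < d) :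
    dotProduct (P.vec d (.n i)) (P.vec d (.n j)) = 0 ↔ i ≠ j := by
  have hd := h.dim
  rw [vec_n, vec_n, rowVec_dotProduct hd, midSum_single (by omega) (by omega)]
  simp [eq_comm]

theorem dot_n_star {i : ℕ} :
    dotProduct (P.vec d (.n i)) (P.vec d .star) = 0 ↔ i ≠ 0 := by
  have hd := h.dim
  have hs := h.s_pos.ne'
  rw [vec_n, vec_star, rowVec_dotProduct hd, midSum_single (by omega) (by omega)]
  simp [hs, eq_comm]

theorem dot_star_star :
    dotProduct (P.vec d .star) (P.vec d .star) ≠ 0 := by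
  have hd := h.dim
  rw [vec_star, rowVec_dotProduct hd, midSum_single (by omega) (by omega), if_pos rfl]
  nlinarith [h.sq_add]

theorem dot_n_v {i : ℕ} (k : ℕ) :
    dotProduct (P.vec d (.n i)) (P.vec d (.v k)) = 0 ↔ k % 4 < 2 ∨ i ≠ 0 := by
  have hd := h.dim
  have hc := h.c_ne
  have hs := h.s_pos
  have hq := h.q_pos
  have hp := h.p_ne
  rw [vec_v, vec_n]
  obtain ⟨j, rfl | rfl | rfl | rfl⟩ := exists_four_mul_add k
  · rw [unitVec_zero, rowVec_dotProduct hd, midSum_zero_right]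
    simp
  · rw [unitVec_one, rowVec_dotProduct hd, midSum_zero_right]
    refine iff_of_true (by simp) (by omega)
  · rw [unitVec_two, rowVec_dotProduct hd, midSum_single le_rfl (by omega)]
    have : (4 * j + 2) % 4 = 2 := by omega
    simp [this, hc, hq.ne', eq_comm]
  · rw [unitVec_three, rowVec_dotProduct hd, midSum_single le_rfl (by omega)]
    have : (4 * j + 3) % 4 = 3 := by omega
    simp [this, hc, hp, hs.ne', eq_comm]

theorem dot_star_v (k : ℕ) :
    dotProduct (P.vec d .star) (P.vec d (.v k)) = 0 ↔ 2 ≤ k % 4 := by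
  have hd := h.dim
  have hc := h.c_ne
  have hs := h.s_pos
  have hq := h.q_pos
  have hp := h.p_ne
  rw [vec_v, vec_star]
  obtain ⟨j, rfl | rfl | rfl | rfl⟩ := exists_four_mul_add k
  · rw [unitVec_zero, rowVec_dotProduct hd, midSum_zero_right]
    simp [hc, hq.ne']
  · rw [unitVec_one, rowVec_dotProduct hd, midSum_zero_right]
    refine iff_of_false (by simp [hc, hp, hs.ne']) (by omega)
  · rw [unitVec_two, rowVec_dotProduct hd, midSum_single le_rfl (by omega), if_pos rfl]
    refine iff_of_true (by ring) (by omega)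
  · rw [unitVec_three, rowVec_dotProduct hd, midSum_single le_rfl (by omega), if_pos rfl]
    refine iff_of_true (by ring) (by omega)

/-- For indices of equal parity all terms have the same sign. For opposite parity the product is `p
q` times a difference of two powers of `s`, and since `0 < s < 1` these agree only if the exponents
do, that is, for neighbours on the path. By symmetry it is enough to treat ordered residues modulo
4. -/
theorem dot_v_v_of_mod_le {k l : ℕ} (hkl : k % 4 ≤ l % 4) :
    dotProduct (P.vec d (.v k)) (P.vec d (.v l)) = 0 ↔ k + 1 = l ∨ l + 1 = k := by
  have hd := h.dim
  have hc := h.c_ne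
  have hs := h.s_pos
  have hq := h.q_pos
  have hp := h.p_ne
  have hpp := mul_self_pos.2 hp
  have hspow (n : ℕ) : 0 < P.s ^ n := by positivity
  have hsq := h.sq_add
  rw [vec_v, vec_v]
  obtain ⟨i, rfl | rfl | rfl | rfl⟩ := exists_four_mul_add k <;>
  obtain ⟨j, rfl | rfl | rfl | rfl⟩ := exists_four_mul_add l <;> (try omega)
  · rw [unitVec_zero, unitVec_zero, rowVec_dotProduct hd, midSum_zero_right]
    refine iff_of_false ?_ (by omega)
    have := hspow (2 * i)
    have := hspow (2 * j)
    rw [show -P.q * -P.q + 0 + P.p * P.s ^ (2 * i) * (P.p * P.s ^ (2 * j)) =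
      P.q * P.q + P.p * P.p * P.s ^ (2 * i) * P.s ^ (2 * j) by ring]
    positivity
  · rw [unitVec_zero, unitVec_one, rowVec_dotProduct hd, midSum_zero_right,
      show -P.q * (P.p * P.s ^ (2 * j)) + 0 + P.p * P.s ^ (2 * i) * P.q =
        P.p * P.q * (P.s ^ (2 * i) - P.s ^ (2 * j)) by ring,
      mul_eq_zero_iff_left (by positivity), sub_eq_zero, h.pow_inj]
    omega
  · rw [unitVec_zero, unitVec_two, rowVec_dotProduct hd, midSum_zero_left, ← neg_eq_zero]
    refine iff_of_false ?_ (by omega)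
    have := hspow (2 * i)
    have := hspow (2 * j + 1)
    rw [show -(-P.q * (P.q * P.s) + 0 + P.p * P.s ^ (2 * i) * -(P.p * P.s ^ (2 * j + 1))) =
      P.q * P.q * P.s + P.p * P.p * P.s ^ (2 * i) * P.s ^ (2 * j + 1) by ring]
    positivity
  · rw [unitVec_zero, unitVec_three, rowVec_dotProduct hd, midSum_zero_left,
      show -P.q * (P.p * P.s ^ (2 * j + 2)) + 0 + P.p * P.s ^ (2 * i) * P.q =
        P.p * P.q * (P.s ^ (2 * i) - P.s ^ (2 * j + 2)) by ring,
      mul_eq_zero_iff_left (by positivity), sub_eq_zero, h.pow_inj]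
    omega
  · rw [unitVec_one, unitVec_one, rowVec_dotProduct hd, midSum_zero_right]
    refine iff_of_false ?_ (by omega)
    have := hspow (2 * i)
    have := hspow (2 * j)
    rw [show P.p * P.s ^ (2 * i) * (P.p * P.s ^ (2 * j)) + 0 + P.q * P.q =
      P.q * P.q + P.p * P.p * P.s ^ (2 * i) * P.s ^ (2 * j) by ring]
    positivity
  · rw [unitVec_one, unitVec_two, rowVec_dotProduct hd, midSum_zero_left,
      show P.p * P.s ^ (2 * i) * (P.q * P.s) + 0 + P.q * -(P.p * P.s ^ (2 * j + 1)) =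
        P.p * P.q * (P.s ^ (2 * i + 1) - P.s ^ (2 * j + 1)) by ring,
      mul_eq_zero_iff_left (by positivity), sub_eq_zero, h.pow_inj]
    omega
  · rw [unitVec_one, unitVec_three, rowVec_dotProduct hd, midSum_zero_left]
    refine iff_of_false ?_ (by omega)
    have := hspow (2 * i)
    have := hspow (2 * j + 2)
    rw [show P.p * P.s ^ (2 * i) * (P.p * P.s ^ (2 * j + 2)) + 0 + P.q * P.q =
      P.q * P.q + P.p * P.p * P.s ^ (2 * i) * P.s ^ (2 * j + 2) by ring]
    positivity
  · rw [unitVec_two, unitVec_two, rowVec_dotProduct hd, midSum_single le_rfl (by omega),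
      if_pos rfl]
    refine iff_of_false ?_ (by omega)
    have := hspow (2 * i + 1)
    have := hspow (2 * j + 1)
    rw [show P.q * P.s * (P.q * P.s) + P.q * P.c * (P.q * P.c) +
      -(P.p * P.s ^ (2 * i + 1)) * -(P.p * P.s ^ (2 * j + 1)) =
      P.q * P.q * (P.s ^ 2 + P.c ^ 2) + P.p * P.p * P.s ^ (2 * i + 1) * P.s ^ (2 * j + 1) by ring,
      hsq]
    positivity
  · rw [unitVec_two, unitVec_three, rowVec_dotProduct hd, midSum_single le_rfl (by omega),
      if_pos rfl,
      show P.q * P.s * (P.p * P.s ^ (2 * j + 2)) + P.q * P.c * (P.p * P.s ^ (2 * j + 1) * P.c) +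
        -(P.p * P.s ^ (2 * i + 1)) * P.q =
        P.p * P.q * (P.s ^ (2 * j + 1) * (P.s ^ 2 + P.c ^ 2) - P.s ^ (2 * i + 1)) by ring,
      hsq, mul_one, mul_eq_zero_iff_left (by positivity), sub_eq_zero, h.pow_inj]
    omega
  · rw [unitVec_three, unitVec_three, rowVec_dotProduct hd, midSum_single le_rfl (by omega),
      if_pos rfl]
    refine iff_of_false ?_ (by omega)
    have := hspow (2 * i + 1)
    have := hspow (2 * j + 1)
    rw [show P.p * P.s ^ (2 * i + 2) * (P.p * P.s ^ (2 * j + 2)) +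
      P.p * P.s ^ (2 * i + 1) * P.c * (P.p * P.s ^ (2 * j + 1) * P.c) + P.q * P.q =
      P.q * P.q + P.p * P.p * P.s ^ (2 * i + 1) * P.s ^ (2 * j + 1) * (P.s ^ 2 + P.c ^ 2) by ring,
      hsq]
    positivity

theorem dot_v_v (k l : ℕ) :
    dotProduct (P.vec d (.v k)) (P.vec d (.v l)) = 0 ↔ k + 1 = l ∨ l + 1 = k := by
  rcases le_total (k % 4) (l % 4) with hkl | hkl
  · exact h.dot_v_v_of_mod_le hkl
  · rw [dotProduct_comm, h.dot_v_v_of_mod_le hkl, or_comm]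

theorem dot_eq_zero_iff {a b : Kind} (ha : a.Valid d) (hb : b.Valid d) :
    dotProduct (P.vec d a) (P.vec d b) = 0 ↔ Kind.Adj d a b := by
  cases a <;> cases b <;> simp only [Kind.Adj, Kind.Rel, Kind.Valid, or_false, false_or] at *
  case m.m => exact iff_of_false (h.dot_m_m hb) (by simp)
  case m.x => rw [dotProduct_comm, h.dot_x_m hb ha]
  case m.n => rw [dotProduct_comm, h.dot_n_m ha]
  case m.star => rw [dotProduct_comm, h.dot_star_m ha]
  case m.v => exact iff_of_false (h.dot_m_v ha _) (by simp)
  case x.m => rw [h.dot_x_m ha hb]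
  case x.x => rw [h.dot_x_x ha hb]; tauto
  case x.n => exact iff_of_false (h.dot_x_n ha hb) (by simp)
  case x.star => exact iff_of_false (h.dot_x_star ha) (by simp)
  case x.v => rw [h.dot_x_v ha]
  case n.m => rw [h.dot_n_m hb]
  case n.x => rw [dotProduct_comm]; exact iff_of_false (h.dot_x_n hb ha) (by simp)
  case n.n => rw [h.dot_n_n hb]; tauto
  case n.star => rw [h.dot_n_star]
  case n.v => rw [h.dot_n_v]
  case star.m => rw [h.dot_star_m hb]
  case star.x => rw [dotProduct_comm]; exact iff_of_false (h.dot_x_star hb) (by simp)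
  case star.n => rw [dotProduct_comm, h.dot_n_star]
  case star.star => exact iff_of_false h.dot_star_star (by simp)
  case star.v => rw [h.dot_star_v]
  case v.m => rw [dotProduct_comm]; exact iff_of_false (h.dot_m_v hb _) (by simp)
  case v.x => rw [dotProduct_comm, h.dot_x_v hb]
  case v.n => rw [dotProduct_comm, h.dot_n_v]
  case v.star => rw [dotProduct_comm, h.dot_star_v]
  case v.v => rw [h.dot_v_v]

end Good

end Params

/-! ### From the parameters to the vectors of the construction -/

/-- The numbers of the construction for the angle `θ` and the parameter `κ`. -/
noncomputable def params (d : ℕ) (θ κ : ℝ) : Params where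
  s := Real.sin θ
  c := Real.cos θ
  κ := κ
  a := coefA d θ κ
  e := coefE d θ κ
  p := coefP d θ κ
  q := coefQ d κ

theorem rowVec_smul (d : ℕ) (r a b : ℝ) (f : ℕ → ℝ) :
    r • rowVec d a f b = rowVec d (r * a) (fun l => r * f l) (r * b) := by
  ext i
  simp only [rowVec, Pi.smul_apply, smul_eq_mul]
  split_ifs <;> rfl

theorem rawVec_m_last {d t : ℕ} {θ κ : ℝ} (hd : 3 ≤ d) (hq : coefQ d κ ≠ 0) {j : Fin d}
    (hj : ¬ (j : ℕ) + 1 < d) :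
    rawVec d t θ κ (m j) =
      (coefQ d κ)⁻¹ • (params d θ κ).unitVec d (4 * t + 2) := by
  have hj0 : (j : ℕ) ≠ 0 := by omega
  rw [Params.unitVec_two, rowVec_smul]
  simp only [rawVec, hj0, hj, if_false, params]
  congr 1
  · field_simp
  · ext l
    split_ifs
    · field_simp
    · simp
  · field_simp

/-- The scalar differs from 1 only at the last distinguished vertex, whose vector is the path vector
number `4t+2` divided by `q`. -/
theorem exists_rawVec_eq {d t : ℕ} {θ κ : ℝ} (hd : 3 ≤ d) (hq : coefQ d κ ≠ 0)
    (u : GadgetVertex d t) :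
    ∃ r : ℝ, r ≠ 0 ∧ rawVec d t θ κ u = r • (params d θ κ).vec d u.kind := by
  by_cases hu : ∃ j : Fin d, ¬ (j : ℕ) + 1 < d ∧ u = m j
  · obtain ⟨j, hj, rfl⟩ := hu
    refine ⟨(coefQ d κ)⁻¹, inv_ne_zero hq, ?_⟩
    rw [rawVec_m_last hd hq hj, kind, if_neg hj]
    rfl
  · refine ⟨1, one_ne_zero, ?_⟩
    rw [one_smul]
    cases u with
    | m j =>
      have hj : (j : ℕ) + 1 < d := by
        by_contra h
        exact hu ⟨j, h, rfl⟩
      rw [kind, if_pos hj]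
      simp only [rawVec, Params.vec, params]
      split_ifs with h0
      · ext l
        simp only [rowVec, h0]
        split_ifs <;> rfl
      · rfl
    | _ => rfl

theorem norm_toLp_ofReal_sq {d : ℕ} (x : Fin d → ℝ) :
    ‖(WithLp.toLp 2 (fun i => (x i : ℂ)) : EuclideanSpace ℂ (Fin d))‖ ^ 2 = dotProduct x x := by
  rw [EuclideanSpace.norm_sq_eq]
  simp [dotProduct, sq]

theorem inner_toLp_ofReal {d : ℕ} (x y : Fin d → ℝ) :
    inner ℂ (WithLp.toLp 2 (fun i => (x i : ℂ)) : EuclideanSpace ℂ (Fin d))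
      (WithLp.toLp 2 (fun i => (y i : ℂ))) = (dotProduct x y : ℝ) := by
  simp [EuclideanSpace.inner_eq_star_dotProduct, dotProduct, mul_comm]

theorem inner_gadgetVec (d t : ℕ) (θ κ : ℝ) (u u' : GadgetVertex d t) :
    inner ℂ (gadgetVec d t θ κ u) (gadgetVec d t θ κ u') =
      (((√(dotProduct (rawVec d t θ κ u) (rawVec d t θ κ u)))⁻¹ *
        (√(dotProduct (rawVec d t θ κ u') (rawVec d t θ κ u')))⁻¹ *
        dotProduct (rawVec d t θ κ u) (rawVec d t θ κ u') : ℝ) : ℂ) := by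
  simp only [gadgetVec, inner_smul_left, inner_smul_right, inner_toLp_ofReal,
    ← norm_toLp_ofReal_sq, Real.sqrt_sq (norm_nonneg _), Complex.conj_ofReal]
  push_cast
  ring

/-! ### Distinct vertices have distinct neighbourhoods -/

namespace Kind

/-- The kinds of the vertices of the graph with `t + 1` repeating units. -/
def Occurs (d t : ℕ) (a : Kind) : Prop := a.Valid d ∧ ∀ k, a = v k → k ≤ 4 * t + 3

/-- The kinds `a` and `b` are separated by the neighbourhood of some vertex. -/
def Separated (d t : ℕ) (a b : Kind) : Prop := ∃ y, Occurs d t y ∧ ¬ (Adj d a y ↔ Adj d b y)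

theorem Separated.symm {d t : ℕ} {a b : Kind} (h : Separated d t a b) : Separated d t b a := by
  obtain ⟨y, hy, hab⟩ := h
  exact ⟨y, hy, fun h => hab h.symm⟩

theorem occurs_x {d t i : ℕ} (hi : i < d) : Occurs d t (x i) := ⟨hi, by simp⟩

theorem occurs_v {d t k : ℕ} (hk : k ≤ 4 * t + 3) : Occurs d t (v k) :=
  ⟨trivial, fun l hl => by simp_all⟩

theorem separated_v_v {d t k l : ℕ} (hkl : k < l) (hl : l ≤ 4 * t + 3) :
    Separated d t (v k) (v l) := by
  -- The vertex `v (l - 1)` separates unless it is a common neighbour of both. In that case the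
  -- other neighbour of `v l` does, or, at the end of the path, the other neighbour of `v k`.
  by_cases h1 : k + 2 = l
  · by_cases h2 : l = 4 * t + 3
    · exact ⟨v (4 * t), occurs_v (by omega), by simp [Adj, Rel]; omega⟩
    · exact ⟨v (l + 1), occurs_v (by omega), by simp [Adj, Rel]; omega⟩
  · exact ⟨v (l - 1), occurs_v (by omega), by simp [Adj, Rel]; omega⟩

theorem separated_m {d t j : ℕ} (hd : 3 ≤ d) (hj : j + 1 < d) {b : Kind} (hb : m j ≠ b) :
    Separated d t (m j) b := by
  cases b with
  | x i =>
    -- Three indices are available because `3 ≤ d`.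
    obtain ⟨k, hk, hki, hkj⟩ : ∃ k, k < 3 ∧ k ≠ i ∧ k ≠ j := by
      by_contra! h
      have := h 0; have := h 1; have := h 2
      omega
    exact ⟨x k, occurs_x (by omega), by simp [Adj, Rel]; omega⟩
  | m i =>
    have : j ≠ i := fun h => hb (by rw [h])
    exact ⟨x j, occurs_x (by omega), by simp [Adj, Rel]; omega⟩
  | _ => exact ⟨x j, occurs_x (by omega), by simp [Adj, Rel] <;> omega⟩

theorem separated_x {d t i : ℕ} (hd : 3 ≤ d) {b : Kind} (hb : b.Valid d) (hb : x i ≠ b) :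
    Separated d t (x i) b := by
  cases b with
  | m j => exact (separated_m hd ‹_› hb.symm).symm
  | x j =>
    have : i ≠ j := fun h => hb (by rw [h])
    exact ⟨x j, occurs_x ‹_›, by simp [Adj, Rel]; omega⟩
  | _ =>
    -- With `k < 2` the vertex `x k` is not the last one, so it has no neighbour on the path.
    obtain ⟨k, hk, hki⟩ : ∃ k, k < 2 ∧ k ≠ i := ⟨if i = 0 then 1 else 0, by grind⟩
    exact ⟨x k, occurs_x (by omega), by simp [Adj, Rel]; omega⟩

theorem separated_of_ne {d t : ℕ} (hd : 3 ≤ d) {a b : Kind} (ha : a.Occurs d t)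
    (hb : b.Occurs d t) (hab : a ≠ b) : Separated d t a b := by
  have hn (i : ℕ) (hi : i + 2 < d) (k : ℕ) : Separated d t (n i) (v k) := by
    by_cases hk : k = 1
    · exact ⟨v 1, occurs_v (by omega), by simp [Adj, Rel]; omega⟩
    · exact ⟨v 0, occurs_v (by omega), by simp [Adj, Rel]; omega⟩
  have hstar (k : ℕ) : Separated d t star (v k) := by
    by_cases hk : k = 1 ∨ k = 3
    · exact ⟨v 3, occurs_v (by omega), by simp [Adj, Rel]; omega⟩
    · exact ⟨v 2, occurs_v (by omega), by simp [Adj, Rel]; omega⟩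
  have hns (i : ℕ) : Separated d t (n i) star :=
    ⟨v 0, occurs_v (by omega), by simp [Adj, Rel]⟩
  cases a with
  | m j => exact separated_m hd ha.1 hab
  | x i => exact separated_x hd hb.1 hab
  | n i =>
    cases b with
    | m j => exact (separated_m hd hb.1 hab.symm).symm
    | x i => exact (separated_x hd ha.1 hab.symm).symm
    | n j =>
      have : i ≠ j := fun h => hab (by rw [h])
      exact ⟨n i, ha, by simp [Adj, Rel]; omega⟩
    | star => exact hns i
    | v k => exact hn i ha.1 k
  | star =>
    cases b with
    | m j => exact (separated_m hd hb.1 hab.symm).symm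
    | x i => exact (separated_x hd ha.1 hab.symm).symm
    | n j => exact (hns j).symm
    | star => exact absurd rfl hab
    | v k => exact hstar k
  | v k =>
    cases b with
    | m j => exact (separated_m hd hb.1 hab.symm).symm
    | x i => exact (separated_x hd ha.1 hab.symm).symm
    | n j => exact (hn j hb.1 k).symm
    | star => exact (hstar k).symm
    | v l =>
      have : k ≠ l := fun h => hab (by rw [h])
      rcases lt_or_gt_of_ne this with h | h
      · exact separated_v_v h (hb.2 l rfl)
      · exact (separated_v_v h (ha.2 k rfl)).symm

theorem exists_kind_eq {d t : ℕ} (hd : 3 ≤ d) {a : Kind} (ha : a.Occurs d t) :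
    ∃ u : GadgetVertex d t, u.kind = a := by
  obtain ⟨ha, hk⟩ := ha
  cases a with
  | m j => exact ⟨.m ⟨j, Nat.lt_of_succ_lt ha⟩, if_pos ha⟩
  | x i => exact ⟨.x ⟨i, ha⟩, rfl⟩
  | n i => exact ⟨.n ⟨i, Nat.lt_sub_of_add_lt ha⟩, rfl⟩
  | star => exact ⟨.nLast, rfl⟩
  | v k =>
    have := hk k rfl
    rcases (show k < 4 * t + 2 ∨ k = 4 * t + 2 ∨ k = 4 * t + 3 by omega) with h | rfl | rfl
    · exact ⟨.v ⟨k, h⟩, rfl⟩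
    · exact ⟨.m ⟨d - 1, by omega⟩, if_neg (by simp; omega)⟩
    · exact ⟨.w, rfl⟩

end Kind

theorem GadgetVertex.kind_occurs {d t : ℕ} (u : GadgetVertex d t) : u.kind.Occurs d t := by
  refine ⟨u.kind_valid, fun k hk => ?_⟩
  cases u with
  | m j => simp only [kind] at hk; split_ifs at hk; simp_all; omega
  | v l => simp only [kind, Kind.v.injEq] at hk; omega
  | w => simp only [kind, Kind.v.injEq] at hk; omega
  | _ => simp [kind] at hk

/-- No two vertices have the same neighbours. -/
theorem exists_not_adj_iff {d t : ℕ} (hd : 3 ≤ d) {u u' : GadgetVertex d t} (huu : u ≠ u') :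
    ∃ y, ¬ ((gadgetGraph d t).Adj u y ↔ (gadgetGraph d t).Adj u' y) := by
  obtain ⟨y, hy, h⟩ :=
    Kind.separated_of_ne hd u.kind_occurs u'.kind_occurs (kind_injective.ne huu)
  obtain ⟨y, rfl⟩ := Kind.exists_kind_eq hd hy
  exact ⟨y, by rwa [gadgetGraph_adj_iff, gadgetGraph_adj_iff]⟩

/-! ### The faithful representation, the clique number and the faithful dimension -/

/-- Vectors that are nonzero multiples of each other are orthogonal to the same vectors, so their
vertices would have the same neighbours. -/
theorem isFaithfulOrthRep_gadgetVec {d : ℕ} (t : ℕ) {θ κ : ℝ} (h : (params d θ κ).Good d) :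
    IsFaithfulOrthRep (gadgetGraph d t) d (gadgetVec d t θ κ) := by
  have hd := h.dim
  have hq : coefQ d κ ≠ 0 := h.q_pos.ne'
  have hdot (u u' : GadgetVertex d t) :
      dotProduct (rawVec d t θ κ u) (rawVec d t θ κ u') = 0 ↔ (gadgetGraph d t).Adj u u' := by
    obtain ⟨r, hr, hu⟩ := exists_rawVec_eq (θ := θ) hd hq u
    obtain ⟨r', hr', hu'⟩ := exists_rawVec_eq (θ := θ) hd hq u'
    rw [hu, hu', smul_dotProduct, dotProduct_smul, gadgetGraph_adj_iff,
      ← h.dot_eq_zero_iff u.kind_valid u'.kind_valid]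
    simp [hr, hr']
  -- The vectors are nonzero by the diagonal case of `hdot`, as no vertex is adjacent to itself.
  have hself (u : GadgetVertex d t) : √(dotProduct (rawVec d t θ κ u) (rawVec d t θ κ u)) ≠ 0 := by
    rw [← norm_toLp_ofReal_sq, Real.sqrt_sq (norm_nonneg _), ← sq_eq_zero_iff.ne,
      norm_toLp_ofReal_sq, Ne, hdot]
    exact SimpleGraph.irrefl _
  have horth (u u' : GadgetVertex d t) :
      inner ℂ (gadgetVec d t θ κ u) (gadgetVec d t θ κ u') = 0 ↔ (gadgetGraph d t).Adj u u' := by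
    rw [inner_gadgetVec, Complex.ofReal_eq_zero, ← hdot, mul_eq_zero_iff_left]
    exact mul_ne_zero (inv_ne_zero (hself u)) (inv_ne_zero (hself u'))
  refine ⟨fun u => ?_, horth, fun u u' huu z hz => ?_⟩
  · have := hself u
    rw [← norm_toLp_ofReal_sq, Real.sqrt_sq (norm_nonneg _)] at this
    simp only [gadgetVec, norm_smul, Complex.norm_real, norm_inv, norm_norm]
    exact inv_mul_cancel₀ this
  · have hz0 : z ≠ 0 := by
      rintro rfl
      refine SimpleGraph.irrefl _ ((horth u u).1 ?_)
      simp [hz]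
    obtain ⟨y, hy⟩ := exists_not_adj_iff hd huu
    refine hy ?_
    rw [← horth, ← horth, hz, inner_smul_left]
    simp [hz0]

/-- A clique is represented by an orthonormal family. This bounds the clique number from above and,
applied to the clique of the `x i`, the dimension from below. -/
theorem IsFaithfulOrthRep.card_le {V : Type*} {G : SimpleGraph V} {n : ℕ}
    {f : V → EuclideanSpace ℂ (Fin n)} (hf : IsFaithfulOrthRep G n f) {C : Finset V}
    (hC : G.IsClique (C : Set V)) : C.card ≤ n := by
  have ho : Orthonormal ℂ (fun c : C => f c) :=
    ⟨fun c => hf.unit c, fun c c' hcc => (hf.orth_iff c c').2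
      (hC c.2 c'.2 fun h => hcc (Subtype.ext h))⟩
  simpa using ho.linearIndependent.fintype_card_le_finrank

section Basis

variable (d t : ℕ)

/-- The clique of the vertices `x i`. -/
def basisClique : Finset (GadgetVertex d t) :=
  Finset.univ.map ⟨x, fun _ _ h => by simpa using h⟩

variable {d t} in
theorem mem_basisClique {u : GadgetVertex d t} : u ∈ basisClique d t ↔ ∃ i, x i = u := by
  simp [basisClique, ← Function.Embedding.toFun_eq_coe]

theorem isNClique_basisClique : (gadgetGraph d t).IsNClique d (basisClique d t) := by
  rw [SimpleGraph.isNClique_iff]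
  refine ⟨?_, by simp [basisClique]⟩
  intro u hu u' hu' huu
  obtain ⟨i, rfl⟩ := mem_basisClique.1 hu
  obtain ⟨j, rfl⟩ := mem_basisClique.1 hu'
  rw [gadgetGraph_adj_iff]
  left
  intro h
  exact huu (by rw [Fin.ext h])

end Basis

theorem IsFaithfulOrthRep.cliqueNum_gadgetGraph {d t : ℕ}
    {f : GadgetVertex d t → EuclideanSpace ℂ (Fin d)}
    (hf : IsFaithfulOrthRep (gadgetGraph d t) d f) : (gadgetGraph d t).cliqueNum = d := by
  obtain ⟨C, hC⟩ := (gadgetGraph d t).exists_isNClique_cliqueNum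
  refine le_antisymm ?_ ?_
  · rw [← hC.card_eq]
    exact hf.card_le hC.isClique
  · have := (isNClique_basisClique d t).isClique.card_le_cliqueNum
    rwa [(isNClique_basisClique d t).card_eq] at this

theorem IsFaithfulOrthRep.faithfulDim_gadgetGraph {d t : ℕ}
    {f : GadgetVertex d t → EuclideanSpace ℂ (Fin d)}
    (hf : IsFaithfulOrthRep (gadgetGraph d t) d f) : faithfulDim (gadgetGraph d t) = d := by
  refine le_antisymm (Nat.sInf_le ⟨f, hf⟩) (le_csInf ⟨d, f, hf⟩ ?_)
  rintro n ⟨g, hg⟩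
  have := hg.card_le (isNClique_basisClique d t).isClique
  rwa [(isNClique_basisClique d t).card_eq] at this

/-! ### Colorings that omit a single distinguished vertex -/

namespace Kind

/-- The vertices of value one in the coloring that leaves out the distinguished vertex `i`. -/
def One (d i : ℕ) : Kind → Prop
  | m j => j ≠ i
  | x j => j = i
  | n _ => False
  | star => False
  | v k => k % 2 = 0 ↔ i + 1 < d

/-- A proper coloring with `d - 1` colors of the vertices of value zero. -/
def color (d i : ℕ) : Kind → ℕ
  | m _ => d - 2
  | x j => if j + 1 = d then i else j
  | n i => i
  | star => 0
  | v _ => d - 2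

theorem not_adj_of_one {d i : ℕ} {a b : Kind} (ha : a.One d i) (hb : b.One d i) :
    ¬ Adj d a b := by
  cases a <;> cases b <;> simp only [Adj, Rel, One] at * <;> grind

theorem color_lt {d i : ℕ} (hd : 3 ≤ d) (hi : i < d) {a : Kind} (ha : a.Valid d)
    (h1 : ¬ a.One d i) : a.color d i < d - 1 := by
  cases a <;> simp only [Valid, One, color] at * <;> (try split_ifs) <;> omega

/-- The vertices of value zero among the `m` and `v` are pairwise non-adjacent and share the color
`d - 2`. As `x i` has value one, its color `i` is free for the last `x`. The vertices `n 0` and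
`star` are not adjacent and share the color 0. -/
theorem color_ne {d i : ℕ} (hd : 3 ≤ d) {a b : Kind} (ha : a.Valid d)
    (hb : b.Valid d) (h1 : ¬ a.One d i) (h2 : ¬ b.One d i) (hab : Adj d a b) :
    a.color d i ≠ b.color d i := by
  cases a <;> cases b <;> simp only [Valid, Adj, Rel, One, color] at * <;> grind

end Kind

open Classical in
/-- The coloring that leaves out the distinguished vertex `i`. -/
noncomputable def omitColoring {d t : ℕ} (i : Fin d) (u : GadgetVertex d t) : Fin 2 :=
  if u.kind.One d i then 1 else 0

theorem omitColoring_eq_one {d t : ℕ} {i : Fin d} {u : GadgetVertex d t} :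
    omitColoring i u = 1 ↔ u.kind.One d i := by
  simp [omitColoring]

theorem isZeroOneColoring_of_independent {V : Type*} {G : SimpleGraph V} {f : V → Fin 2}
    (h1 : ∀ u u', f u = 1 → f u' = 1 → ¬ G.Adj u u')
    (h2 : ∀ C, G.IsNClique G.cliqueNum C → ∃ u ∈ C, f u = 1) : IsZeroOneColoring G f := by
  have huniq {C : Finset V} (hC : G.IsClique (C : Set V)) {u u' : V} (hu : u ∈ C) (hu' : u' ∈ C)
      (hfu : f u = 1) (hfu' : f u' = 1) : u = u' := by
    by_contra hne
    exact h1 u u' hfu hfu' (hC hu hu' hne)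
  have hzero {x : V} (hx : f x ≠ 1) : (f x : ℕ) = 0 := by
    have := (f x).2
    have : (f x : ℕ) ≠ 1 := fun h => hx (Fin.ext h)
    omega
  refine ⟨fun C hC => ?_, fun C hC => ?_⟩
  · by_cases hex : ∃ u ∈ C, f u = 1
    · obtain ⟨u, hu, hfu⟩ := hex
      rw [Finset.sum_eq_single_of_mem u hu, hfu]
      · rfl
      · exact fun u' hu' hne => hzero fun h => hne (huniq hC hu' hu h hfu)
    · push Not at hex
      rw [Finset.sum_eq_zero fun u hu => hzero (hex u hu)]
      exact zero_le_one
  · obtain ⟨u, hu, hfu⟩ := h2 C hC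
    exact ⟨u, ⟨hu, hfu⟩, fun u' hu' => huniq hC.isClique hu'.1 hu hu'.2 hfu⟩

theorem isZeroOneColoring_omitColoring {d t : ℕ} (hd : 3 ≤ d)
    (hclique : (gadgetGraph d t).cliqueNum = d) (i : Fin d) :
    IsZeroOneColoring (gadgetGraph d t) (omitColoring i) := by
  refine isZeroOneColoring_of_independent (fun u u' hu hu' => ?_) fun C hC => ?_
  · rw [gadgetGraph_adj_iff]
    exact Kind.not_adj_of_one (omitColoring_eq_one.1 hu) (omitColoring_eq_one.1 hu')
  · by_contra! h
    simp only [ne_eq, omitColoring_eq_one] at h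
    -- A clique without a one would be mapped injectively to the `d - 1` colors.
    have hcard : C.card ≤ (Finset.range (d - 1)).card := by
      refine Finset.card_le_card_of_injOn (fun u => u.kind.color d i) (fun u hu => ?_)
        fun u hu u' hu' huu => ?_
      · simpa using Kind.color_lt hd i.2 u.kind_valid (h u hu)
      · by_contra hne
        have := hC.isClique hu hu' hne
        rw [gadgetGraph_adj_iff] at this
        exact Kind.color_ne hd u.kind_valid u'.kind_valid (h u hu) (h u' hu') this huu
    rw [hC.card_eq, hclique, Finset.card_range] at hcard
    omega

/-! ### No coloring gives the value one to all distinguished vertices -/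

theorem IsZeroOneColoring.eq_zero_of_adj {V : Type*} {G : SimpleGraph V} {f : V → Fin 2}
    (hf : IsZeroOneColoring G f) {u u' : V} (h : G.Adj u u') (hu : f u = 1) : f u' ≠ 1 := by
  classical
  intro hu'
  have := hf.1 {u, u'} (by simpa [SimpleGraph.isClique_pair] using fun _ => h)
  rw [Finset.sum_pair h.ne, hu, hu'] at this
  simp at this

section Forbid

variable {d t : ℕ} {f : GadgetVertex d t → Fin 2}

theorem basisClique_last_eq_one (hd : 3 ≤ d) (hclique : (gadgetGraph d t).cliqueNum = d)
    (hf : IsZeroOneColoring (gadgetGraph d t) f) (hm : ∀ j, f (m j) = 1) :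
    f (x ⟨d - 1, by omega⟩) = 1 := by
  obtain ⟨u, ⟨hu, hfu⟩, -⟩ := hf.2 (basisClique d t) (by
    rw [hclique]; exact isNClique_basisClique d t)
  obtain ⟨i, rfl⟩ := mem_basisClique.1 hu
  by_cases hi : (i : ℕ) + 1 < d
  · refine absurd hfu (hf.eq_zero_of_adj (u := m i) ?_ (hm i))
    rw [gadgetGraph_adj_iff]
    simp [kind, hi, Kind.Adj, Kind.Rel]
  · convert hfu
    have := i.2
    omega

/-- The vertices `v (2 * k)` and `v (2 * k + 1)` form a maximum clique with their common neighbours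
among the shared vertices, so one of the two has value one if no shared vertex has. -/
theorem eq_one_of_eq_zero (hd : 3 ≤ d) (hclique : (gadgetGraph d t).cliqueNum = d)
    (hf : IsZeroOneColoring (gadgetGraph d t) f)
    (hn : ∀ i, f (n i) ≠ 1) (hstar : f nLast ≠ 1) {k : ℕ} {u u' : GadgetVertex d t}
    (hu : u.kind = .v (2 * k)) (hu' : u'.kind = .v (2 * k + 1)) (hfu : f u ≠ 1) : f u' = 1 := by
  classical
  have huu : u ≠ u' := by
    rintro rfl
    rw [hu] at hu'
    simp at hu'
  -- In the second half of a unit (`k` odd) the path vertices are not adjacent to `n 0`; there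
  -- `nLast` takes its place.
  let g : Fin (d - 2) → GadgetVertex d t :=
    fun i => if (i : ℕ) = 0 ∧ k % 2 = 1 then nLast else n i
  have hgk (i : Fin (d - 2)) : (g i).kind =
      if (i : ℕ) = 0 ∧ k % 2 = 1 then Kind.star else Kind.n i := by
    simp only [g]
    split_ifs <;> rfl
  have hgadj (i j : Fin (d - 2)) (hij : i ≠ j) : (gadgetGraph d t).Adj (g i) (g j) := by
    have : (i : ℕ) ≠ j := fun h => hij (Fin.ext h)
    rw [gadgetGraph_adj_iff, hgk, hgk]
    split_ifs <;> simp only [Kind.Adj, Kind.Rel] <;> omega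
  have hgu (i : Fin (d - 2)) : (gadgetGraph d t).Adj (g i) u := by
    rw [gadgetGraph_adj_iff, hgk, hu]
    split_ifs <;> simp only [Kind.Adj, Kind.Rel] <;> omega
  have hgu' (i : Fin (d - 2)) : (gadgetGraph d t).Adj (g i) u' := by
    rw [gadgetGraph_adj_iff, hgk, hu']
    split_ifs <;> simp only [Kind.Adj, Kind.Rel] <;> omega
  have hadj : (gadgetGraph d t).Adj u u' := by
    rw [gadgetGraph_adj_iff, hu, hu']
    simp [Kind.Adj, Kind.Rel]
  have hginj : Function.Injective g := by
    intro i j hij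
    by_contra hne
    exact (hgadj i j hne).ne hij
  have hC : (gadgetGraph d t).IsNClique d (insert u (insert u' (Finset.univ.image g))) := by
    have h0 : (gadgetGraph d t).IsNClique (d - 2) (Finset.univ.image g) := by
      rw [SimpleGraph.isNClique_iff]
      refine ⟨?_, by rw [Finset.card_image_of_injective _ hginj]; simp⟩
      intro y hy y' hy' hyy
      simp only [Finset.coe_image, Finset.coe_univ, Set.image_univ, Set.mem_range] at hy hy'
      obtain ⟨i, rfl⟩ := hy
      obtain ⟨j, rfl⟩ := hy'
      exact hgadj i j fun h => hyy (by rw [h])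
    have h1 := (h0.insert (a := u') (by simpa using fun i => (hgu' i).symm)).insert (a := u)
      (by simpa using ⟨hadj, fun i => (hgu i).symm⟩)
    rwa [show d - 2 + 1 + 1 = d by omega] at h1
  obtain ⟨y, ⟨hy, hfy⟩, -⟩ := hf.2 _ (by rw [hclique]; exact hC)
  simp only [Finset.mem_insert, Finset.mem_image, Finset.mem_univ, true_and] at hy
  rcases hy with rfl | rfl | ⟨i, rfl⟩
  · exact absurd hfy hfu
  · exact hfy
  · simp only [g] at hfy
    split_ifs at hfy
    · exact absurd hfy hstar
    · exact absurd hfy (hn i)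

theorem exists_m_ne_one (hd : 3 ≤ d) (hclique : (gadgetGraph d t).cliqueNum = d)
    (hf : IsZeroOneColoring (gadgetGraph d t) f) : ∃ j, f (m j) ≠ 1 := by
  by_contra! hm
  have hx := basisClique_last_eq_one hd hclique hf hm
  have hn (i : Fin (d - 2)) : f (n i) ≠ 1 := by
    refine hf.eq_zero_of_adj (u := m ⟨0, by omega⟩) ?_ (hm _)
    rw [gadgetGraph_adj_iff]
    simp [kind, Kind.Adj, Kind.Rel, show 1 < d by omega]
  have hstar : f nLast ≠ 1 := by
    refine hf.eq_zero_of_adj (u := m ⟨1, by omega⟩) ?_ (hm _)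
    rw [gadgetGraph_adj_iff]
    simp [kind, Kind.Adj, Kind.Rel, show 2 < d by omega]
  have key : ∀ k, k ≤ 2 * t + 1 → ∀ u : GadgetVertex d t, u.kind = .v (2 * k) → f u ≠ 1 := by
    intro k
    induction k with
    | zero =>
      intro _ u hu
      refine hf.eq_zero_of_adj ?_ hx
      rw [gadgetGraph_adj_iff, hu]
      simp [kind, Kind.Adj, Kind.Rel, show d - 1 + 1 = d by omega]
    | succ k ih =>
      intro hk u hu
      obtain ⟨y, hy⟩ := Kind.exists_kind_eq hd (Kind.occurs_v (d := d) (t := t) (k := 2 * k)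
        (by omega))
      obtain ⟨y', hy'⟩ := Kind.exists_kind_eq hd (Kind.occurs_v (d := d) (t := t)
        (k := 2 * k + 1) (by omega))
      refine hf.eq_zero_of_adj (u := y') ?_
        (eq_one_of_eq_zero hd hclique hf hn hstar hy hy' (ih (by omega) y hy))
      rw [gadgetGraph_adj_iff, hu, hy']
      simp [Kind.Adj, Kind.Rel]
      omega
  -- The path vertex `2 * (2t+1) = 4t+2` is the last distinguished vertex.
  refine key (2 * t + 1) le_rfl (m ⟨d - 1, by omega⟩) ?_ (hm _)
  simp [kind, show ¬ d - 1 + 1 < d by omega]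
  omega

end Forbid

theorem isOrderGadget_gadgetGraph {d t : ℕ} (hd : 3 ≤ d)
    (hrep : ∃ f, IsFaithfulOrthRep (gadgetGraph d t) d f) :
    IsOrderGadget (gadgetGraph d t) (Set.range m) d (d - 1) d := by
  obtain ⟨f, hf⟩ := hrep
  have hclique := hf.cliqueNum_gadgetGraph
  have hinj : Function.Injective (m : Fin d → GadgetVertex d t) := fun _ _ h => by simpa using h
  have hcard : (Set.range (m : Fin d → GadgetVertex d t)).ncard = d := by
    rw [← Set.image_univ, Set.ncard_image_of_injective _ hinj, Set.ncard_univ, Nat.card_fin]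
  refine ⟨inferInstance, ⟨_, isZeroOneColoring_omitColoring hd hclique ⟨0, by omega⟩⟩, ⟨f, hf⟩,
    hf.faithfulDim_gadgetGraph, hclique, ?_, hcard, ?_, ?_⟩
  · rintro _ ⟨i, rfl⟩ _ ⟨j, rfl⟩ -
    rw [gadgetGraph_adj_iff]
    simp only [kind]
    split_ifs <;> simp [Kind.Adj, Kind.Rel]
  · intro R hR hRc
    obtain ⟨_, ⟨i, rfl⟩, hi⟩ : ∃ u ∈ Set.range (m : Fin d → GadgetVertex d t), u ∉ R := by
      by_contra! h
      rw [Set.Subset.antisymm hR h, hcard] at hRc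
      omega
    refine ⟨_, isZeroOneColoring_omitColoring hd hclique i, fun u hu => ?_⟩
    obtain ⟨j, rfl⟩ := hR hu
    have hij : (j : ℕ) ≠ i := fun h => hi (by rwa [← Fin.ext h])
    rw [omitColoring_eq_one, kind]
    split_ifs
    · exact hij
    · simp only [Kind.One]
      omega
  · intro g hg
    obtain ⟨j, hj⟩ := exists_m_ne_one hd hclique hg
    have hlt : {u ∈ Set.range (m : Fin d → GadgetVertex d t) | g u = 1}.ncard <
        (Set.range (m : Fin d → GadgetVertex d t)).ncard :=
      Set.ncard_lt_ncard ⟨fun u hu => hu.1, fun h => hj (h ⟨j, rfl⟩).2⟩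
    omega

/-! ### The root `a` of the quadratic equation -/

section Coefficients

variable {d : ℕ} {θ κ : ℝ}

theorem coefA_neg (hs : 0 < Real.sin θ) (hc : Real.cos θ ≠ 0) : coefA d θ κ < 0 := by
  rw [coefA, neg_div, neg_lt_zero]
  have := Real.sqrt_nonneg (Real.sin θ ^ 2 - ((d : ℝ) - 4) * (Real.cos θ ^ 2 + κ ^ 2))
  have : 0 < Real.cos θ ^ 2 := by positivity
  positivity

theorem coefA_mul (hs : 0 < Real.sin θ) :
    coefA d θ κ *
      (Real.sin θ + √(Real.sin θ ^ 2 - ((d : ℝ) - 4) * (Real.cos θ ^ 2 + κ ^ 2))) =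
      -(Real.cos θ ^ 2 + κ ^ 2) := by
  have := Real.sqrt_nonneg (Real.sin θ ^ 2 - ((d : ℝ) - 4) * (Real.cos θ ^ 2 + κ ^ 2))
  exact div_mul_cancel₀ _ (by positivity)

theorem coefA_quadratic (hs : 0 < Real.sin θ)
    (hΔ : 0 ≤ Real.sin θ ^ 2 - ((d : ℝ) - 4) * (Real.cos θ ^ 2 + κ ^ 2)) :
    Real.cos θ ^ 2 + ((d : ℝ) - 4) * coefA d θ κ ^ 2 + 2 * coefA d θ κ * Real.sin θ + κ ^ 2 = 0 := by
  have h1 := coefA_mul (d := d) (κ := κ) hs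
  have h2 := Real.sq_sqrt hΔ
  have h0 := Real.sqrt_nonneg (Real.sin θ ^ 2 - ((d : ℝ) - 4) * (Real.cos θ ^ 2 + κ ^ 2))
  set r := √(Real.sin θ ^ 2 - ((d : ℝ) - 4) * (Real.cos θ ^ 2 + κ ^ 2))
  set a := coefA d θ κ
  have h3 : r - Real.sin θ = ((d : ℝ) - 4) * a := by
    have h4 : Real.sin θ + r ≠ 0 := by positivity
    refine mul_right_cancel₀ h4 ?_
    linear_combination h2 - ((d : ℝ) - 4) * h1
  linear_combination h1 - a * h3

/-- The quadratic equation expresses `κ²` through `a`. -/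
theorem coefA_injOn (hs : 0 < Real.sin θ) :
    Set.InjOn (coefA d θ) {κ | 0 < κ ∧
      0 ≤ Real.sin θ ^ 2 - ((d : ℝ) - 4) * (Real.cos θ ^ 2 + κ ^ 2)} := by
  rintro κ ⟨hκ, h⟩ κ' ⟨hκ', h'⟩ hh
  have h1 := coefA_quadratic hs h
  have h2 := coefA_quadratic hs h'
  rw [hh] at h1
  exact (pow_left_inj₀ hκ.le hκ'.le two_ne_zero).1 (by linarith)

theorem continuousAt_coefA (hs : 0 < Real.sin θ) (κ : ℝ) : ContinuousAt (coefA d θ) κ := by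
  unfold coefA
  have := Real.sqrt_nonneg (Real.sin θ ^ 2 - ((d : ℝ) - 4) * (Real.cos θ ^ 2 + κ ^ 2))
  refine ContinuousAt.div (by fun_prop) (by fun_prop) (by positivity)

theorem coefP_mul (hc : Real.cos θ ≠ 0) :
    coefP d θ κ * Real.cos θ = coefE d θ κ ^ 2 + ((d : ℝ) - 2) * κ ^ 2 :=
  div_mul_cancel₀ _ hc

/-- At `κ = 0` one has `cos² θ = -a (sin θ + √Δ)`, so the sum equals `-a √Δ` with `a < 0`. -/
theorem cos_sq_add_sin_mul_coefA_pos (hs : 0 < Real.sin θ) (hc : Real.cos θ ≠ 0)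
    (hΔ : 0 < Real.sin θ ^ 2 - ((d : ℝ) - 4) * (Real.cos θ ^ 2 + 0 ^ 2)) :
    0 < Real.cos θ ^ 2 + Real.sin θ * coefA d θ 0 := by
  have h1 := coefA_mul (d := d) (κ := 0) hs
  have h2 := coefA_neg (d := d) (κ := 0) hs hc
  have h3 := Real.sqrt_pos.2 hΔ
  nlinarith

end Coefficients

/-! ### Choice of `κ` and `θ` -/

open Polynomial in
theorem countable_setOf_eval_eq_zero {f : ℝ → ℝ} {T : Set ℝ} (hf : Set.InjOn f T)
    {Q : ℕ → ℝ[X]} (hQ : ∀ j, Q j ≠ 0) : {κ ∈ T | ∃ j, (Q j).eval (f κ) = 0}.Countable := by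
  have h : (⋃ j, {y | (Q j).IsRoot y}).Countable :=
    Set.countable_iUnion fun j => (Polynomial.finite_setOfPred_isRoot (hQ j)).countable
  refine Set.MapsTo.countable_of_injOn (f := f) ?_ (hf.mono fun κ hκ => hκ.1) h
  rintro κ ⟨-, j, hj⟩
  exact Set.mem_iUnion.2 ⟨j, hj⟩

open Polynomial in
-- In terms of `a` each condition says that `a` is not a root of a certain nonzero polynomial. Since
-- `a` is an injective function of `κ`, only countably many `κ` are excluded for all `j` together,
-- while the interval is uncountable.
theorem exists_mem_Ioo_forall_ne {d : ℕ} {θ u : ℝ} (hs : 0 < Real.sin θ)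
    (hc : Real.cos θ ≠ 0) (he : 0 < coefE d θ 0) (hu : 0 < u)
    (hΔ : ∀ κ ∈ Set.Ico 0 u, 0 ≤ Real.sin θ ^ 2 - ((d : ℝ) - 4) * (Real.cos θ ^ 2 + κ ^ 2)) :
    ∃ κ ∈ Set.Ioo 0 u, ∀ j : ℕ,
      coefP d θ κ * Real.cos θ * Real.sin θ ^ (2 * j) ≠ ((d : ℝ) - 2) * κ ^ 2 ∧
      coefP d θ κ * Real.cos θ * Real.sin θ ^ (2 * j + 1) * (Real.sin θ - coefA d θ κ) ≠
        ((d : ℝ) - 2) * κ ^ 2 := by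
  set s := Real.sin θ with hs_def
  set c := Real.cos θ
  -- As polynomials in `a`: `K` is `κ²`, `E` is `e`, hence `E ^ 2 + C (d - 2) * K` is `p cos θ`.
  let K : ℝ[X] := -(C ((d : ℝ) - 4) * X ^ 2) - C (2 * s) * X - C (c ^ 2)
  let E : ℝ[X] := C ((d : ℝ) - 3) * X + C s
  let Q (j : ℕ) : ℝ[X] :=
    (E ^ 2 + C ((d : ℝ) - 2) * K) * C (s ^ (2 * j)) - C ((d : ℝ) - 2) * K
  let R (j : ℕ) : ℝ[X] :=
    (E ^ 2 + C ((d : ℝ) - 2) * K) * C (s ^ (2 * j + 1)) * (C s - X) - C ((d : ℝ) - 2) * K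
  have hK (κ : ℝ) (hκ : κ ∈ Set.Ico 0 u) : K.eval (coefA d θ κ) = κ ^ 2 := by
    have := coefA_quadratic hs (hΔ κ hκ)
    simp only [K, eval_sub, eval_neg, eval_mul, eval_C, eval_pow, eval_X]
    linear_combination -this
  have hE (κ : ℝ) : E.eval (coefA d θ κ) = coefE d θ κ := by
    simp [E, coefE, s]
  have h0 : (0 : ℝ) ∈ Set.Ico 0 u := ⟨le_rfl, hu⟩
  have ha := coefA_neg (d := d) (κ := 0) hs hc
  -- At the value of `a` belonging to `κ = 0` the terms with `K` vanish, and a positive multiple of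
  -- `e²` remains.
  have hQ (j : ℕ) : Q j ≠ 0 := by
    intro h
    have h1 : (Q j).eval (coefA d θ 0) = 0 := by rw [h, eval_zero]
    simp only [Q, eval_sub, eval_add, eval_mul, eval_pow, eval_C, hK 0 h0, hE] at h1
    have : 0 < coefE d θ 0 ^ 2 * s ^ (2 * j) := by positivity
    nlinarith
  have hR (j : ℕ) : R j ≠ 0 := by
    intro h
    have h1 : (R j).eval (coefA d θ 0) = 0 := by rw [h, eval_zero]
    simp only [R, eval_sub, eval_add, eval_mul, eval_pow, eval_C, eval_X, hK 0 h0, hE] at h1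
    have : 0 < s - coefA d θ 0 := by linarith
    have : 0 < coefE d θ 0 ^ 2 * s ^ (2 * j + 1) * (s - coefA d θ 0) := by positivity
    nlinarith
  have hinj : Set.InjOn (coefA d θ) (Set.Ioo 0 u) :=
    (coefA_injOn (d := d) hs).mono fun κ hκ => show 0 < κ ∧ _ from ⟨hκ.1, hΔ κ (Set.Ioo_subset_Ico_self hκ)⟩
  have hcount := (countable_setOf_eval_eq_zero hinj hQ).union
    (countable_setOf_eval_eq_zero hinj hR)
  obtain ⟨κ, hκ, hbad⟩ : ∃ κ ∈ Set.Ioo 0 u, κ ∉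
      {κ ∈ Set.Ioo 0 u | ∃ j, (Q j).eval (coefA d θ κ) = 0} ∪
      {κ ∈ Set.Ioo 0 u | ∃ j, (R j).eval (coefA d θ κ) = 0} := by
    by_contra! h
    exact Cardinal.Real.Ioo_countable_iff.not.2 (not_le.2 hu) (hcount.mono h)
  have hκ' : κ ∈ Set.Ico 0 u := ⟨hκ.1.le, hκ.2⟩
  refine ⟨κ, hκ, fun j => ⟨fun h => hbad (Or.inl ⟨hκ, j, ?_⟩),
    fun h => hbad (Or.inr ⟨hκ, j, ?_⟩)⟩⟩
  · simp only [Q, eval_sub, eval_add, eval_mul, eval_pow, eval_C, hK κ hκ', hE,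
      ← coefP_mul (d := d) (κ := κ) hc]
    exact sub_eq_zero.2 h
  · simp only [R, eval_sub, eval_add, eval_mul, eval_pow, eval_C, eval_X, hK κ hκ', hE,
      ← coefP_mul (d := d) (κ := κ) hc]
    exact sub_eq_zero.2 h

/-- The open conditions are checked at `κ = 0` and persist on an interval `[0, u)`; a generic `κ >
0` in it satisfies the others. -/
theorem exists_good {d : ℕ} (hd : 3 ≤ d) {θ : ℝ} (hs : 0 < Real.sin θ)
    (hc : Real.cos θ ≠ 0) (hΔ : 0 < Real.sin θ ^ 2 - ((d : ℝ) - 4) * (Real.cos θ ^ 2 + 0 ^ 2))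
    (he : 0 < coefE d θ 0) : ∃ κ : ℝ, 0 < κ ∧ (params d θ κ).Good d := by
  have hd' : (3 : ℝ) ≤ d := by exact_mod_cast hd
  have hs1 : Real.sin θ < 1 := by
    have := Real.sin_sq_add_cos_sq θ
    have : 0 < Real.cos θ ^ 2 := by positivity
    nlinarith
  have hA := continuousAt_coefA (d := d) hs 0
  have hE : ContinuousAt (coefE d θ) 0 := by
    unfold coefE
    fun_prop
  have ha0 := coefA_neg (d := d) (κ := 0) hs hc
  have hes : coefE d θ 0 ≤ Real.sin θ := by
    rw [coefE]
    nlinarith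
  have h1 : ∀ᶠ κ in 𝓝 (0 : ℝ),
      0 < Real.sin θ ^ 2 - ((d : ℝ) - 4) * (Real.cos θ ^ 2 + κ ^ 2) :=
    ContinuousAt.eventually_lt (by fun_prop) (by fun_prop) hΔ
  have h2 : ∀ᶠ κ in 𝓝 (0 : ℝ), 0 < coefE d θ κ :=
    ContinuousAt.eventually_lt (by fun_prop) hE he
  have h3 : ∀ᶠ κ in 𝓝 (0 : ℝ), 0 < Real.cos θ ^ 2 + Real.sin θ * coefA d θ κ :=
    ContinuousAt.eventually_lt (by fun_prop) (by fun_prop)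
      (cos_sq_add_sin_mul_coefA_pos hs hc hΔ)
  have h4 : ∀ᶠ κ in 𝓝 (0 : ℝ), (coefE d θ κ ^ 2 + ((d : ℝ) - 2) * κ ^ 2) * Real.sin θ <
      ((d : ℝ) - 2) * coefE d θ κ :=
    ContinuousAt.eventually_lt (by fun_prop) (by fun_prop) (by
      -- At `κ = 0` the claim reads `e² sin θ < (d - 2) e`, and `d - 2 ≥ 1`.
      have : coefE d θ 0 * Real.sin θ < 1 := by nlinarith
      nlinarith)
  -- For `d = 3` one has `e = sin θ`, and the two sides agree at `κ = 0`.
  have h5 : ∀ᶠ κ in 𝓝 (0 : ℝ), 3 < d →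
      coefE d θ κ ^ 2 + ((d : ℝ) - 2) * κ ^ 2 < Real.sin θ * coefE d θ κ := by
    rw [eventually_imp_distrib_left]
    intro h
    have h' : (3 : ℝ) < d := by exact_mod_cast h
    refine ContinuousAt.eventually_lt (by fun_prop) (by fun_prop) ?_
    have : coefE d θ 0 < Real.sin θ := by
      rw [coefE]
      nlinarith
    nlinarith
  obtain ⟨u, hu, hball⟩ := Metric.eventually_nhds_iff.1 (h1.and (h2.and (h3.and (h4.and h5))))
  have hball' (κ : ℝ) (hκ : κ ∈ Set.Ico 0 u) := hball (y := κ) (by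
    rw [Real.dist_eq, sub_zero, abs_of_nonneg hκ.1]
    exact hκ.2)
  obtain ⟨κ, hκ, hne⟩ := exists_mem_Ioo_forall_ne hs hc he hu fun κ hκ => (hball' κ hκ).1.le
  obtain ⟨g1, g2, g3, g4, g5⟩ := hball' κ ⟨hκ.1.le, hκ.2⟩
  refine ⟨κ, hκ.1, ?_⟩
  have hP := coefP_mul (d := d) (κ := κ) hc
  refine ⟨hd, hs, hs1, hc, Real.sin_sq_add_cos_sq θ, hκ.1, coefA_neg hs hc, g2,
    coefA_quadratic hs g1.le, rfl, rfl, hP, g3.ne', ?_, fun j => ?_, fun j => (hne j).1,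
    fun j => (hne j).2⟩
  · simp only [params]
    rw [hP]
    rcases hd.lt_or_eq with h | rfl
    · exact (g5 h).ne
    -- Here `e = sin θ`, so the left side exceeds the right side by exactly `κ²`.
    · have : 0 < κ ^ 2 := pow_pos hκ.1 2
      simp only [coefE]
      norm_num
      nlinarith
  · simp only [params]
    rw [hP]
    refine (lt_of_le_of_lt ?_ g4).ne
    have : 0 ≤ coefE d θ κ ^ 2 + ((d : ℝ) - 2) * κ ^ 2 := by
      have : 0 ≤ ((d : ℝ) - 2) := by linarith
      positivity
    refine mul_le_mul_of_nonneg_left ?_ this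
    exact pow_le_of_le_one hs.le hs1.le (by omega)

/-- At `θ = π/2` the values are `sin θ = 1`, `Δ = 1`, `a = 0`, `e = 1`. Only `cos θ ≠ 0` requires
the punctured neighbourhood. -/
theorem eventually_angle {d : ℕ} : ∀ᶠ θ in 𝓝[≠] (Real.pi / 2), 0 < Real.sin θ ∧ Real.cos θ ≠ 0 ∧
    0 < Real.sin θ ^ 2 - ((d : ℝ) - 4) * (Real.cos θ ^ 2 + 0 ^ 2) ∧ 0 < coefE d θ 0 := by
  have h1 : ∀ᶠ θ in 𝓝 (Real.pi / 2), 0 < Real.sin θ :=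
    ContinuousAt.eventually_lt (by fun_prop) (by fun_prop) (by simp)
  have h2 : ∀ᶠ θ in 𝓝[≠] (Real.pi / 2), Real.cos θ ≠ 0 :=
    (Real.hasDerivAt_cos _).eventually_ne (by simp)
  have h3 : ∀ᶠ θ in 𝓝 (Real.pi / 2),
      0 < Real.sin θ ^ 2 - ((d : ℝ) - 4) * (Real.cos θ ^ 2 + 0 ^ 2) :=
    ContinuousAt.eventually_lt (by fun_prop) (by fun_prop) (by simp)
  have hA : ContinuousAt (fun θ => coefA d θ 0) (Real.pi / 2) := by
    unfold coefA
    exact ContinuousAt.div (by fun_prop) (by fun_prop) (by simp)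
  have h4 : ∀ᶠ θ in 𝓝 (Real.pi / 2), 0 < coefE d θ 0 := by
    unfold coefE
    exact ContinuousAt.eventually_lt (by fun_prop) (by fun_prop) (by simp [coefA])
  filter_upwards [h1.filter_mono nhdsWithin_le_nhds, h2, h3.filter_mono nhdsWithin_le_nhds,
    h4.filter_mono nhdsWithin_le_nhds] with θ a1 a2 a3 a4
  exact ⟨a1, a2, a3, a4⟩

/-! ### Overlaps of the distinguished vectors -/

section Overlap

variable {d t : ℕ} {θ κ : ℝ}

theorem rawVec_m (hd : 3 ≤ d) (j : Fin d) :
    rawVec d t θ κ (m j) = rowVec d (if (j : ℕ) = 0 then 1 else Real.sin θ)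
      (fun l => if l = anchor d j then Real.cos θ else 0)
      (if (j : ℕ) + 1 < d then 0
        else -(coefP d θ κ / coefQ d κ * Real.sin θ ^ (2 * t + 1))) := by
  ext l
  have := j.2
  by_cases h0 : (j : ℕ) = 0
  · simp only [rawVec, rowVec, anchor, h0, if_true]
    grind
  · by_cases h1 : (j : ℕ) + 1 < d
    · simp [rawVec, rowVec, anchor, h0, h1, h1.ne]
    · simp [rawVec, rowVec, anchor, h0, show (j : ℕ) + 1 = d by omega]

theorem midSum_anchor (hd : 3 ≤ d) (j : Fin d) (f : ℕ → ℝ) (z : ℝ) :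
    midSum d f (fun l => if l = anchor d j then z else 0) =
      if (j : ℕ) = 0 then 0 else f (anchor d j) * z := by
  have := j.2
  split_ifs with h0
  · have : anchor d j = 0 := by rw [anchor]; split_ifs <;> omega
    rw [this, midSum_single_zero]
  · refine midSum_single ?_ ?_ f z <;> rw [anchor] <;> split_ifs <;> omega

/-- The first coordinates contribute at least `sin² θ`; the other contributions are squares or zero.
-/
theorem sin_sq_le_dot_rawVec_m (hd : 3 ≤ d) (hs : 0 < Real.sin θ) (i j : Fin d) :
    Real.sin θ ^ 2 ≤ dotProduct (rawVec d t θ κ (m i)) (rawVec d t θ κ (m j)) := by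
  rw [rawVec_m hd, rawVec_m hd, rowVec_dotProduct hd, midSum_anchor hd]
  have hs1 := Real.sin_le_one θ
  have h1 : Real.sin θ ^ 2 ≤ (if (i : ℕ) = 0 then 1 else Real.sin θ) *
      (if (j : ℕ) = 0 then 1 else Real.sin θ) := by
    split_ifs <;> nlinarith
  have h2 : 0 ≤ (if (j : ℕ) = 0 then 0 else
      (if anchor d j = anchor d i then Real.cos θ else 0) * Real.cos θ) := by
    split_ifs <;> nlinarith [mul_self_nonneg (Real.cos θ)]
  have h3 (b : ℝ) : 0 ≤ (if (i : ℕ) + 1 < d then 0 else b) * (if (j : ℕ) + 1 < d then 0 else b) := by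
    split_ifs <;> nlinarith [mul_self_nonneg b]
  have := h3 (-(coefP d θ κ / coefQ d κ * Real.sin θ ^ (2 * t + 1)))
  linarith

theorem dot_rawVec_m_self_le (hd : 3 ≤ d) (j : Fin d) :
    dotProduct (rawVec d t θ κ (m j)) (rawVec d t θ κ (m j)) ≤
      1 + (coefP d θ κ / coefQ d κ * Real.sin θ ^ (2 * t + 1)) ^ 2 := by
  rw [rawVec_m hd, rowVec_dotProduct hd, midSum_anchor hd]
  generalize coefP d θ κ / coefQ d κ * Real.sin θ ^ (2 * t + 1) = b
  have := Real.sin_sq_add_cos_sq θ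
  simp only [if_true]
  split_ifs <;> nlinarith [sq_nonneg b]

theorem sin_sq_div_le_inner_m (hd : 3 ≤ d) (hs : 0 < Real.sin θ) (i j : Fin d) :
    ∃ r : ℝ, inner ℂ (gadgetVec d t θ κ (m i)) (gadgetVec d t θ κ (m j)) = (r : ℂ) ∧
      Real.sin θ ^ 2 / (1 + (coefP d θ κ / coefQ d κ * Real.sin θ ^ (2 * t + 1)) ^ 2) ≤ r := by
  refine ⟨_, inner_gadgetVec d t θ κ (m i) (m j), ?_⟩
  have hij := sin_sq_le_dot_rawVec_m (t := t) (κ := κ) hd hs i j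
  have hi := sin_sq_le_dot_rawVec_m (t := t) (κ := κ) hd hs i i
  have hj := sin_sq_le_dot_rawVec_m (t := t) (κ := κ) hd hs j j
  have hi' := dot_rawVec_m_self_le (t := t) (θ := θ) (κ := κ) hd i
  have hj' := dot_rawVec_m_self_le (t := t) (θ := θ) (κ := κ) hd j
  have hs2 : 0 < Real.sin θ ^ 2 := by positivity
  set A := dotProduct (rawVec d t θ κ (m i)) (rawVec d t θ κ (m i))
  set B := dotProduct (rawVec d t θ κ (m j)) (rawVec d t θ κ (m j))
  set M := 1 + (coefP d θ κ / coefQ d κ * Real.sin θ ^ (2 * t + 1)) ^ 2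
  have hM : 0 ≤ M := by linarith
  have hA : 0 < √A := Real.sqrt_pos.2 (by linarith)
  have hB : 0 < √B := Real.sqrt_pos.2 (by linarith)
  have hAB : √A * √B ≤ M :=
    calc √A * √B ≤ √M * √M := by gcongr
      _ = M := Real.mul_self_sqrt hM
  have hD := hs2.le.trans hij
  rw [← mul_inv, inv_mul_eq_div]
  gcongr

/-- The inner product is real, at most 1 by Cauchy–Schwarz, and bounded below by a quantity with
limit `sin² θ > 1 - ε`. The bound does not depend on `i` and `j`. -/
theorem eventually_norm_inner_sub_one_lt (h : (params d θ κ).Good d) {ε : ℝ}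
    (hε : 1 - ε < Real.sin θ ^ 2) :
    ∀ᶠ t : ℕ in atTop, ∀ i j : Fin d,
      ‖inner ℂ (gadgetVec d t θ κ (m i)) (gadgetVec d t θ κ (m j)) - 1‖ < ε := by
  have hs : 0 < Real.sin θ := h.s_pos
  have hs1 : Real.sin θ < 1 := h.s_lt
  have hpow : Tendsto (fun t : ℕ => Real.sin θ ^ (2 * t + 1)) atTop (𝓝 0) :=
    (tendsto_pow_atTop_nhds_zero_of_lt_one hs.le hs1).comp
      (tendsto_atTop_mono (fun t => by simp only [id]; omega) tendsto_id)
  have hlim : Tendsto (fun t : ℕ => Real.sin θ ^ 2 /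
      (1 + (coefP d θ κ / coefQ d κ * Real.sin θ ^ (2 * t + 1)) ^ 2)) atTop
      (𝓝 (Real.sin θ ^ 2)) := by
    have := (tendsto_const_nhds (x := Real.sin θ ^ 2)).div
      (((hpow.const_mul (coefP d θ κ / coefQ d κ)).pow 2).const_add 1) (by simp)
    simpa [Pi.div_def] using this
  filter_upwards [hlim.eventually_const_lt hε] with t ht i j
  have hrep := isFaithfulOrthRep_gadgetVec t h
  obtain ⟨r, hr, hle⟩ := sin_sq_div_le_inner_m (t := t) (κ := κ) h.dim hs i j
  have h1 := norm_inner_le_norm (𝕜 := ℂ) (gadgetVec d t θ κ (m i)) (gadgetVec d t θ κ (m j))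
  rw [hrep.unit, hrep.unit, hr, Complex.norm_real, Real.norm_eq_abs, one_mul] at h1
  have h2 := le_of_abs_le h1
  rw [hr, ← Complex.ofReal_one, ← Complex.ofReal_sub, Complex.norm_real, Real.norm_eq_abs,
    abs_of_nonpos (by linarith)]
  linarith

end Overlap

theorem mainTheorem2 (d : ℕ) (hd : 3 ≤ d) :
    (∀ t : ℕ, IsOrderGadget (gadgetGraph d t) (Set.range GadgetVertex.m) d (d - 1) d) ∧
    (∀ ε : ℝ, 0 < ε → ∀ᶠ θ : ℝ in 𝓝[≠] (Real.pi / 2), ∃ κ : ℝ, 0 < κ ∧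
      (∀ t : ℕ, IsFaithfulOrthRep (gadgetGraph d t) d (gadgetVec d t θ κ)) ∧
      ∀ᶠ t : ℕ in atTop, ∀ i j : Fin d,
        ‖inner ℂ (gadgetVec d t θ κ (GadgetVertex.m i))
          (gadgetVec d t θ κ (GadgetVertex.m j)) - 1‖ < ε) := by
  refine ⟨fun t => ?_, fun ε hε => ?_⟩
  -- For the gadget any one admissible angle suffices.
  · obtain ⟨θ, hs, hc, hΔ, he⟩ := (eventually_angle (d := d)).exists
    obtain ⟨κ, -, h⟩ := exists_good hd hs hc hΔ he
    exact isOrderGadget_gadgetGraph hd ⟨_, isFaithfulOrthRep_gadgetVec t h⟩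
  · have h1 : ∀ᶠ θ in 𝓝 (Real.pi / 2), 1 - ε < Real.sin θ ^ 2 :=
      ContinuousAt.eventually_lt (by fun_prop) (by fun_prop) (by simpa using hε)
    filter_upwards [eventually_angle (d := d), h1.filter_mono nhdsWithin_le_nhds]
      with θ ⟨hs, hc, hΔ, he⟩ hθ
    obtain ⟨κ, hκ, h⟩ := exists_good hd hs hc hΔ he
    exact ⟨κ, hκ, fun t => isFaithfulOrthRep_gadgetVec t h, eventually_norm_inner_sub_one_lt h hθ⟩
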